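/- Let $\tau=\frac{1+\sqrt5}{2}$, $\tau'=\frac{1-\sqrt5}{2}$, $\mathcal L=\{(m+n\tau,\,m+n\tau'):m,n\in\mathbb Z\}\subset\mathbb R^2$, and let $\mathcal L^0=\{y\in\mathbb R^2: e^{2\pi i\,x\cdot y}=1\ \forall x\in\mathcal L\}$ be its dual lattice. Points of $\mathcal L$ and $\mathcal L^0$ are written $(x,x^\star)$ and $(y,y^\star)$. Let $\mathbf{Fib}=\{x:(x,x^\star)\in\mathcal L,\ -1\le x^\star<\tau-1\}$ be the Fibonacci model set. A measure on $\mathbb R$ is a complex Radon measure, that is, a linear functional on $C_c(\mathbb R)$ which, for each compact $K$, is bounded in the supremum norm on functions supported in $K$. For $\varphi\in C_c(\mathbb R)$ put $\widetilde\varphi(x)=\overline{\varphi(-x)}$ and $\check\varphi(y)=\int_{\mathbb R}\varphi(x)e^{2\pi i xy}\,dx$. A measure $\mu$ is Fourier transformable if there is a measure $\widehat\mu$ (its Fourier transform, which is then unique) such that, for all $\varphi\in C_c(\mathbb R)$, $\check\varphi\in L^2(|\widehat\mu|)$ and $\mu(\varphi*\widetilde\varphi)=\widehat\mu(|\check\varphi|^2)$.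 Let $h=\frac{27}{8}\,1_{[-\tau-1,\tau+1]}*1_{[-\frac13,\frac13]}*1_{[-\frac13,\frac13]}*1_{[-\frac13,\frac13]}$ and let $$\omega=\sum_{(x,x^\star)\in\mathcal L}h(x^\star)\,\delta_x$$ be the Fibonacci ping-pong measure. A function $\varphi\in C_c(\mathbb R)$ is called auxiliary for $\omega$ if $(\varphi*\widetilde\varphi)(0)=1$ and there is an open set $U\ni0$ such that $\operatorname{supp}(\varphi*\widetilde\varphi)\subseteq U$ and the sets $x+U$, $x\in\operatorname{supp}\omega$, are pairwise disjoint. A van Hove sequence is a sequence $(A_n)$ of compact subsets of $\mathbb R$ of positive Lebesgue measure such that $|\partial^K A_n|/|A_n|\to0$ for every nonempty compact $K\subset\mathbb R$, where $\partial^K B=\big((K+B)\setminus B^\circ\big)\cup\big((-K+\overline{\mathbb R\setminus B})\cap B\big)$. The autocorrelation of $\Lambda\subseteq\mathbb R$ exists with respect to $(A_n)$ if the limit $$\eta(z)=\lim_{n\to\infty}\frac1{|A_n|}\,\#\{(x,y): x,y\in\Lambda\cap A_n,\ x-y=z\}$$ exists for all $z\in\Lambda-\Lambda$; it is then $\gamma_\Lambda=\sum_{z\in\Lambda-\Lambda}\eta(z)\delta_z$.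 **Theorem.** (a) $\omega$ is a Fourier transformable measure, and its Fourier transform is the measure (the weights being absolutely summable over compact sets) $$\widehat\omega=\frac{3+\sqrt5}{\sqrt5}\sum_{(y,y^\star)\in\mathcal L^0}\operatorname{sinc}\big(2\pi(\tau+1)y^\star\big)\,\operatorname{sinc}^3\big(\tfrac{2\pi}{3}y^\star\big)\,\delta_y,\qquad \operatorname{sinc}(t)=\frac{\sin t}{t},\ \operatorname{sinc}(0)=1.$$ (b) Let $\Lambda\subseteq\mathbf{Fib}$ be any subset whose autocorrelation exists with respect to some van Hove sequence, and let $\gamma_\Lambda$ be this autocorrelation. Then $\gamma_\Lambda$ is a Fourier transformable measure, and for every auxiliary function $\varphi$ for $\omega$ the measure $\nu=|\check\varphi|^2\,\widehat{\gamma_\Lambda}$ is finite and $$\widehat{\gamma_\Lambda}=\widehat\omega*\nu .$$ -/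

import Mathlib

open MeasureTheory Filter Topology
open scoped CompactlySupported FourierTransform Pointwise

noncomputable section

namespace FibPingPong

/-! ### Complex Radon measures on the real line -/

/-- A (complex Radon) measure on `ℝ`: a linear functional on `C_c(ℝ, ℂ)` which, for every compact
`K`, is bounded with respect to the supremum norm on the functions supported in `K`. -/
structure RadonMeasure where
  toLinearMap : C_c(ℝ, ℂ) →ₗ[ℂ] ℂ
  locally_bounded : ∀ K : Set ℝ, IsCompact K → ∃ C : ℝ, ∀ (g : C_c(ℝ, ℂ)) (b : ℝ),
    tsupport g ⊆ K → (∀ x, ‖g x‖ ≤ b) → ‖toLinearMap g‖ ≤ C * b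

namespace RadonMeasure

instance : CoeFun RadonMeasure (fun _ => C_c(ℝ, ℂ) → ℂ) where
  coe μ := μ.toLinearMap

instance : Zero RadonMeasure where
  zero := ⟨0, fun _ _ => ⟨0, by simp⟩⟩

/-- `dμ = u dm` is the polar decomposition of `μ`: `m` is a positive, locally finite Borel measure,
`u` is measurable with `|u| = 1`, and `μ(g) = ∫ g u dm` for `g ∈ C_c(ℝ)`. By the Riesz
representation theorem every `μ` has such a decomposition; `m` is then the total variation `|μ|`
and `u` is unique `|μ|`-almost everywhere, so that `∫ f dμ = ∫ f u dm` for `f ∈ L¹(|μ|)`. -/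
structure IsPolar (μ : RadonMeasure) (m : Measure ℝ) (u : ℝ → ℂ) : Prop where
  locallyFinite : IsLocallyFiniteMeasure m
  measurable : Measurable u
  norm_eq_one : ∀ x, ‖u x‖ = 1
  apply_eq : ∀ g : C_c(ℝ, ℂ), μ g = ∫ x, g x * u x ∂m

/-- The measure `μ` is finite: it is bounded for the supremum norm, that is `|μ|(ℝ) < ∞`. -/
def IsFinite (μ : RadonMeasure) : Prop :=
  ∃ C : ℝ, ∀ (g : C_c(ℝ, ℂ)) (b : ℝ), (∀ x, ‖g x‖ ≤ b) → ‖μ g‖ ≤ C * b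

/-- The support of `μ`. -/
def support (μ : RadonMeasure) : Set ℝ :=
  {x | ∀ U ∈ 𝓝 x, ∃ g : C_c(ℝ, ℂ), tsupport g ⊆ U ∧ μ g ≠ 0}

/-- The product `ψ μ` of a continuous function and a measure, `(ψ μ)(g) = μ(ψ g)`. -/
def mulContinuous (ψ : C(ℝ, ℂ)) (μ : RadonMeasure) : RadonMeasure where
  toLinearMap :=
    { toFun := fun g => μ (ψ • g)
      map_add' := fun f g => by
        rw [← map_add]; congr 1; ext x; simp [mul_add]
      map_smul' := fun c g => by
        rw [RingHom.id_apply, ← map_smul]; congr 1; ext x; simp [mul_left_comm] }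
  locally_bounded := by
    intro K hK
    obtain ⟨C, hC⟩ := μ.locally_bounded K hK
    obtain ⟨B, hB⟩ := hK.exists_bound_of_continuousOn ψ.continuous.continuousOn
    refine ⟨C * max B 0, fun g b hg hb => ?_⟩
    have hb0 : 0 ≤ b := (norm_nonneg _).trans (hb 0)
    rw [mul_assoc]
    refine hC (ψ • g) (max B 0 * b) ?_ fun x => ?_
    · refine (closure_mono fun x hx => ?_).trans hg
      simp only [Function.mem_support, CompactlySupportedContinuousMap.coe_smulc, smul_eq_mul,
        ne_eq, mul_eq_zero, not_or] at hx
      exact hx.2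
    · simp only [CompactlySupportedContinuousMap.coe_smulc, smul_eq_mul, norm_mul]
      by_cases hx : x ∈ K
      · exact mul_le_mul ((hB x hx).trans (le_max_left _ _)) (hb x) (norm_nonneg _)
          (le_max_right _ _)
      · have h0 : g x = 0 := image_eq_zero_of_notMem_tsupport fun h => hx (hg h)
        rw [h0, norm_zero, mul_zero]
        positivity

/-- `σ` is the convolution `μ * ν`: every `(s, t) ↦ g (s + t)`, `g ∈ C_c(ℝ)`, is integrable with
respect to `|μ| × |ν|`, and `σ(g) = ∬ g (s + t) dμ(s) dν(t)`. -/
def IsConvolution (μ ν σ : RadonMeasure) : Prop :=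
  ∃ (m : Measure ℝ) (u : ℝ → ℂ) (n : Measure ℝ) (v : ℝ → ℂ), μ.IsPolar m u ∧ ν.IsPolar n v ∧
    ∀ g : C_c(ℝ, ℂ), Integrable (fun p : ℝ × ℝ => g (p.1 + p.2)) (m.prod n) ∧
      σ g = ∫ p : ℝ × ℝ, g (p.1 + p.2) * u p.1 * v p.2 ∂(m.prod n)

end RadonMeasure

/-! ### Weighted Dirac combs -/

/-- The weights `c i` placed at the points `p i` are absolutely summable over compact sets. -/
def LocallySummable {ι : Type*} (p : ι → ℝ) (c : ι → ℂ) : Prop :=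
  ∀ K : Set ℝ, IsCompact K → Summable fun i : {i // p i ∈ K} => ‖c i‖

theorem LocallySummable.summable_norm {ι : Type*} {p : ι → ℝ} {c : ι → ℂ}
    (h : LocallySummable p c) (g : C_c(ℝ, ℂ)) : Summable fun i => ‖c i * g (p i)‖ := by
  obtain ⟨B, hB⟩ := g.hasCompactSupport.isCompact.exists_bound_of_continuousOn
    g.continuous.continuousOn
  have h1 : Summable fun i : {i // p i ∈ tsupport g} => ‖c i * g (p i)‖ := by
    refine Summable.of_nonneg_of_le (fun _ => norm_nonneg _) (fun i => ?_)
      ((h _ g.hasCompactSupport.isCompact).mul_right B)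
    rw [norm_mul]
    exact mul_le_mul_of_nonneg_left (hB _ i.2) (norm_nonneg _)
  refine (Function.Injective.summable_iff
    (Subtype.val_injective (p := fun i => p i ∈ tsupport g)) fun i hi => ?_).1 h1
  have h0 : g (p i) = 0 := image_eq_zero_of_notMem_tsupport fun hx => hi ⟨⟨i, hx⟩, rfl⟩
  simp [h0]

open Classical in
/-- The measure `∑ i, c i • δ_{p i}` (with the value `0` if the weights are not locally
summable, where the sum does not define a measure). -/
def diracComb {ι : Type*} (p : ι → ℝ) (c : ι → ℂ) : RadonMeasure :=
  if h : LocallySummable p c then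
    { toLinearMap :=
        { toFun := fun g => ∑' i, c i * g (p i)
          map_add' := fun f g => by
            rw [← (h.summable_norm f).of_norm.tsum_add (h.summable_norm g).of_norm]
            simp [mul_add]
          map_smul' := fun a g => by
            simp only [CompactlySupportedContinuousMap.coe_smul, Pi.smul_apply, smul_eq_mul,
              RingHom.id_apply]
            rw [← tsum_mul_left]
            simp [mul_left_comm] }
      locally_bounded := by
        intro K hK
        refine ⟨∑' i : {i // p i ∈ K}, ‖c i‖, fun g b hg hb => ?_⟩
        have hz : ∀ i, i ∉ {i | p i ∈ K} → c i * g (p i) = 0 := fun i hi => by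
          have h0 : g (p i) = 0 := image_eq_zero_of_notMem_tsupport fun hx => hi (hg hx)
          simp [h0]
        have he : ∑' i, c i * g (p i) = ∑' i : {i // p i ∈ K}, c i * g (p i) :=
          (tsum_subtype_eq_of_support_subset (f := fun i => c i * g (p i))
            (s := {i | p i ∈ K}) (fun i hi => by
              by_contra hn
              exact hi (hz i hn))).symm
        change ‖∑' i, c i * g (p i)‖ ≤ _
        rw [he, ← tsum_mul_right]
        refine tsum_of_norm_bounded ((h K hK).mul_right b).hasSum fun i => ?_
        rw [norm_mul]
        exact mul_le_mul_of_nonneg_left (hb _) (norm_nonneg _) }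
  else 0

/-! ### The Fourier transform of measures -/

/-- The function `φ * φ~`, where `φ~(x) = conj (φ (-x))`. -/
def selfConv (φ : C_c(ℝ, ℂ)) : C_c(ℝ, ℂ) where
  toFun := convolution φ (fun x => starRingEnd ℂ (φ (-x))) (ContinuousLinearMap.mul ℂ ℂ) volume
  hasCompactSupport' := by
    refine HasCompactSupport.convolution _ φ.hasCompactSupport ?_
    have h := φ.hasCompactSupport.comp_homeomorph (Homeomorph.neg ℝ)
    exact h.comp_left (g := starRingEnd ℂ) (map_zero _)
  continuous_toFun := by
    refine HasCompactSupport.continuous_convolution_left _ φ.hasCompactSupport φ.continuous ?_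
    exact (Complex.continuous_conj.comp
      (φ.continuous.comp continuous_neg)).locallyIntegrable

/-- The inverse Fourier transform `y ↦ ∫ exp (2πi x y) φ(x) dx`. -/
def invFourier (φ : C_c(ℝ, ℂ)) (y : ℝ) : ℂ :=
  ∫ x : ℝ, Complex.exp (2 * Real.pi * Complex.I * (x * y)) * φ x

theorem continuous_invFourier (φ : C_c(ℝ, ℂ)) : Continuous (invFourier φ) := by
  refine continuous_of_dominated (bound := fun x => ‖φ x‖) (fun y => ?_) (fun y => ?_)
    (φ.continuous.norm.integrable_of_hasCompactSupport φ.hasCompactSupport.norm) ?_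
  · exact (Continuous.mul (by fun_prop) φ.continuous).aestronglyMeasurable
  · refine Eventually.of_forall fun x => ?_
    have : 2 * (Real.pi : ℂ) * Complex.I * (x * y) = ((2 * Real.pi * (x * y) : ℝ) : ℂ) * Complex.I := by
      push_cast; ring
    rw [norm_mul, this, Complex.norm_exp_ofReal_mul_I, one_mul]
  · exact Eventually.of_forall fun x => by fun_prop

/-- The continuous function `|φˇ|²`. -/
def normSqInvFourier (φ : C_c(ℝ, ℂ)) : C(ℝ, ℂ) where
  toFun y := ((‖invFourier φ y‖ ^ 2 : ℝ) : ℂ)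
  continuous_toFun :=
    Complex.continuous_ofReal.comp ((continuous_invFourier φ).norm.pow 2)

/-- `μhat` is a Fourier transform of `μ`: for all `φ ∈ C_c(ℝ)`, `φˇ ∈ L²(|μhat|)` and
`μ(φ * φ~) = ∫ |φˇ|² dμhat`. -/
def IsFourierTransform (μ μhat : RadonMeasure) : Prop :=
  ∃ (m : Measure ℝ) (u : ℝ → ℂ), μhat.IsPolar m u ∧ ∀ φ : C_c(ℝ, ℂ),
    MemLp (invFourier φ) 2 m ∧ μ (selfConv φ) = ∫ y, normSqInvFourier φ y * u y ∂m

/-- `μ` is Fourier transformable. -/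
def FourierTransformable (μ : RadonMeasure) : Prop := ∃ μhat, IsFourierTransform μ μhat

open Classical in
/-- The Fourier transform of a Fourier transformable measure (and `0` for other measures). -/
def fourierTransform (μ : RadonMeasure) : RadonMeasure :=
  if h : FourierTransformable μ then h.choose else 0

/-! ### Autocorrelation -/

/-- The `K`-boundary of `B`. -/
def vanHoveBoundary (K B : Set ℝ) : Set ℝ :=
  ((K + B) \ interior B) ∪ ((-K + closure Bᶜ) ∩ B)

/-- Van Hove sequences of compact sets (of positive Lebesgue measure). -/
structure IsVanHove (A : ℕ → Set ℝ) : Prop where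
  isCompact : ∀ n, IsCompact (A n)
  volume_pos : ∀ n, 0 < volume (A n)
  tendsto : ∀ K : Set ℝ, IsCompact K → K.Nonempty →
    Tendsto (fun n => volume (vanHoveBoundary K (A n)) / volume (A n)) atTop (𝓝 0)

/-- The autocorrelation of `Λ` exists with respect to `A`, with coefficients `η`: for every
`z ∈ Λ - Λ`, `η z` is the limit of `|A n|⁻¹ #{(x, y) : x, y ∈ Λ ∩ A n, x - y = z}`. -/
def HasAutocorrelation (A : ℕ → Set ℝ) (Λ : Set ℝ) (η : ℝ → ℝ) : Prop :=
  ∀ z ∈ Λ - Λ, Tendsto (fun n => (volume.real (A n))⁻¹ *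
    (({p : ℝ × ℝ | p.1 ∈ Λ ∩ A n ∧ p.2 ∈ Λ ∩ A n ∧ p.1 - p.2 = z}.ncard : ℕ) : ℝ))
    atTop (𝓝 (η z))

/-- The autocorrelation measure `γ = ∑_{z ∈ Λ - Λ} η(z) δ_z`. -/
def autocorrelation (Λ : Set ℝ) (η : ℝ → ℝ) : RadonMeasure :=
  diracComb (fun z : ↥(Λ - Λ) => (z : ℝ)) (fun z => (η z : ℂ))

/-! ### The Fibonacci model set and its ping-pong measure -/

/-- The lattice `{(m + n τ, m + n τ') : m, n ∈ ℤ}` in `ℝ²`. -/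
def lattice : Set (ℝ × ℝ) :=
  {p | ∃ m n : ℤ, p = (m + n * Real.goldenRatio, m + n * Real.goldenConj)}

/-- The dual lattice `{y ∈ ℝ² : exp (2πi x·y) = 1 for all x ∈ lattice}`. -/
def dualLattice : Set (ℝ × ℝ) :=
  {y | ∀ x ∈ lattice,
    Complex.exp (2 * Real.pi * Complex.I * ((x.1 * y.1 + x.2 * y.2 : ℝ) : ℂ)) = 1}

/-- The Fibonacci model set `{x ∈ ℤ[τ] : x⋆ ∈ [-1, τ - 1)}`. -/
def Fib : Set ℝ := {x | ∃ y, (x, y) ∈ lattice ∧ y ∈ Set.Ico (-1) (Real.goldenRatio - 1)}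

/-- Convolution of two real functions on the line. -/
def conv (f g : ℝ → ℝ) : ℝ → ℝ := convolution f g (ContinuousLinearMap.mul ℝ ℝ) volume

/-- The indicator function of `[-a, a]`. -/
def box (a : ℝ) : ℝ → ℝ := (Set.Icc (-a) a).indicator 1

/-- `h = (27/8) 1_[-τ-1, τ+1] * 1_[-1/3, 1/3] * 1_[-1/3, 1/3] * 1_[-1/3, 1/3]`. -/
def h (x : ℝ) : ℝ :=
  27 / 8 * conv (conv (conv (box (Real.goldenRatio + 1)) (box (1 / 3))) (box (1 / 3)))
    (box (1 / 3)) x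

/-- The ping-pong measure `ω = ∑_{(x, x⋆) ∈ lattice} h(x⋆) δ_x`. -/
def omega : RadonMeasure :=
  diracComb (fun p : lattice => p.1.1) (fun p => (h p.1.2 : ℂ))

/-- The weight of the transform of `omega` at a point `(y, y⋆)` of the dual lattice, as a function
of `t = y⋆`. -/
def omegaHatWeight (t : ℝ) : ℝ :=
  (3 + √5) / √5 *
    (Real.sinc (2 * Real.pi * (Real.goldenRatio + 1) * t) * Real.sinc (2 * Real.pi / 3 * t) ^ 3)

/-- `S` is `U`-uniformly discrete: the translates `x + U`, `x ∈ S`, are pairwise disjoint. -/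
def IsUniformlyDiscrete (U S : Set ℝ) : Prop :=
  ∀ x ∈ S, ∀ y ∈ S, x ≠ y → Disjoint (x +ᵥ U) (y +ᵥ U)

/-- `φ ∈ C_c(ℝ)` is an auxiliary function for `ω`: `(φ * φ~)(0) = 1`, and `φ * φ~` is supported in
an open neighbourhood `U` of `0` for which `supp ω` is `U`-uniformly discrete. -/
def IsAuxiliary (ω : RadonMeasure) (φ : C_c(ℝ, ℂ)) : Prop :=
  ∃ U : Set ℝ, IsOpen U ∧ 0 ∈ U ∧ IsUniformlyDiscrete U ω.support ∧
    tsupport (selfConv φ) ⊆ U ∧ selfConv φ 0 = 1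

end FibPingPong

end

/-! Write f = φ * φ~ and γ = γ_Λ. The window of Fib has length τ, so the star map sends Λ - Λ into
[-τ, τ], where h = 1: every point of Λ - Λ carries ω-mass exactly 1. Suppose f is 1 at 0 and
vanishes at all differences of distinct points of ω. Then testing γ against f translated to a point
x of ω reads off the coefficient of γ at x, which is 0 when x is not in Λ - Λ. Hence γ(g) = ∑ g(x)
h(x⋆) γ(f(· - x)): the autocorrelation is ω multiplied by the continuous function a ↦ γ(f(· - a)).
This is `IsSeparating.autocorrelation_apply`.

That function is the Fourier transform of a finite positive measure ν, because it is the pointwise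
limit of the transforms of |A n|⁻¹ |Φ_nˇ|² dy, where Φ_n is a finite sum of translates of φ, and
Lévy's continuity theorem applies (`HasAutocorrelation.exists_measure`). Multiplying ω by the
transform of ν amounts to convolving its transform with ν, so γ is transformable with transform ω̂ *
ν (`IsSeparating.isFourierTransform`). Polarization shows that |φˇ|² γ̂ and ν have the same Fourier
transform, so they coincide (`IsFourierTransform.mulContinuous_eq`). Transformability of γ needs one
separating function to exist. It does, because |x| |x⋆| ≥ 1 for nonzero lattice points, which keeps
points with bounded x⋆ apart.

Part (a) is Poisson summation for a lattice of covolume √5, applied to f ⊗ h (`tsum_lp_eq_tsum_dp`).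
The weights decay at least like 1/(y⋆)², and dual points over an interval of length 1 have separated
y⋆, so the transform is translation bounded (`translationBounded_dual`). Since φ is merely
continuous, φˇ has no pointwise decay to rely on; its square-integrability against translation
bounded measures comes from writing φˇ as a local average of another θˇ
(`TranslationBounded.memLp`). The transforms are handled as differences of two positive locally
finite measures, and the polar decompositions required by the definitions are recovered by
`exists_polar`. -/

open MeasureTheory Filter Topology
open scoped CompactlySupported FourierTransform Pointwise

noncomputable section

namespace FibPingPong

/-! ### Characters of the real line -/

/-- The character `x ↦ exp (2πi x)`. -/
def ch (x : ℝ) : ℂ := Complex.exp (2 * Real.pi * Complex.I * x)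

theorem ch_eq (x : ℝ) : ch x = Complex.exp (((2 * Real.pi * x : ℝ) : ℂ) * Complex.I) := by
  rw [ch]; congr 1; push_cast; ring

theorem ch_add (x y : ℝ) : ch (x + y) = ch x * ch y := by
  simp only [ch, ← Complex.exp_add]; congr 1; push_cast; ring

@[simp] theorem ch_zero : ch 0 = 1 := by simp [ch]

@[simp] theorem norm_ch (x : ℝ) : ‖ch x‖ = 1 := by
  rw [ch_eq, Complex.norm_exp_ofReal_mul_I]

theorem conj_ch (x : ℝ) : starRingEnd ℂ (ch x) = ch (-x) := by
  rw [ch_eq, ch_eq, ← Complex.exp_conj]; congr 1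
  simp only [map_mul, Complex.conj_ofReal, Complex.conj_I]; push_cast; ring

@[fun_prop]
theorem continuous_ch : Continuous ch := by unfold ch; fun_prop

theorem fourier_eq_ch (f : ℝ → ℂ) (w : ℝ) : 𝓕 f w = ∫ v, ch (-(v * w)) * f v := by
  rw [Real.fourier_eq']
  congr 1; ext v
  rw [ch_eq, smul_eq_mul]
  congr 3
  simp [mul_comm v w]

theorem fourierInv_eq_ch (f : ℝ → ℂ) (w : ℝ) : 𝓕⁻ f w = ∫ v, ch (v * w) * f v := by
  rw [Real.fourierInv_eq_fourier_neg, fourier_eq_ch]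
  simp

theorem invFourier_eq (φ : C_c(ℝ, ℂ)) (y : ℝ) : invFourier φ y = ∫ x, ch (x * y) * φ x := by
  simp only [invFourier, ch, Complex.ofReal_mul]

theorem invFourier_eq_fourier (φ : C_c(ℝ, ℂ)) (y : ℝ) : invFourier φ y = 𝓕 (φ : ℝ → ℂ) (-y) := by
  rw [invFourier_eq, fourier_eq_ch]; simp

theorem integrable_cc (φ : C_c(ℝ, ℂ)) : Integrable φ :=
  φ.continuous.integrable_of_hasCompactSupport φ.hasCompactSupport

theorem integrable_ch_mul {m : Measure ℝ} {f : ℝ → ℂ} (hf : Integrable f m) {k : ℝ → ℝ}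
    (hk : Continuous k) : Integrable (fun x => ch (k x) * f x) m :=
  hf.bdd_mul (c := 1) ((continuous_ch.comp hk).aestronglyMeasurable)
    (Eventually.of_forall fun _ => (norm_ch _).le)

theorem norm_invFourier_le (φ : C_c(ℝ, ℂ)) (y : ℝ) : ‖invFourier φ y‖ ≤ ∫ x, ‖φ x‖ := by
  rw [invFourier_eq]
  refine (norm_integral_le_integral_norm _).trans_eq ?_
  simp

/-! ### Modulations, translations and self-convolutions -/

/-- The modulated function `x ↦ exp (2πi a x) φ(x)`. -/
def modul (φ : C_c(ℝ, ℂ)) (a : ℝ) : C_c(ℝ, ℂ) :=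
  (⟨fun x => ch (a * x), by fun_prop⟩ : C(ℝ, ℂ)) • φ

@[simp] theorem modul_apply (φ : C_c(ℝ, ℂ)) (a x : ℝ) : modul φ a x = ch (a * x) * φ x := by
  simp [modul]

/-- The translated function `x ↦ φ(x - a)`. -/
def trans (φ : C_c(ℝ, ℂ)) (a : ℝ) : C_c(ℝ, ℂ) where
  toFun x := φ (x - a)
  hasCompactSupport' := φ.hasCompactSupport.comp_homeomorph (Homeomorph.subRight a)
  continuous_toFun := φ.continuous.comp (continuous_id.sub continuous_const)

@[simp] theorem trans_apply (φ : C_c(ℝ, ℂ)) (a x : ℝ) : trans φ a x = φ (x - a) := rfl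

theorem invFourier_modul (φ : C_c(ℝ, ℂ)) (a y : ℝ) :
    invFourier (modul φ a) y = invFourier φ (y + a) := by
  simp only [invFourier_eq, modul_apply]
  congr 1; ext x
  rw [← mul_assoc, ← ch_add]; ring_nf

theorem invFourier_trans (φ : C_c(ℝ, ℂ)) (a y : ℝ) :
    invFourier (trans φ a) y = ch (a * y) * invFourier φ y := by
  simp only [invFourier_eq, trans_apply]
  rw [← integral_add_right_eq_self _ a, ← integral_const_mul]
  congr 1; ext x
  rw [add_sub_cancel_right, ← mul_assoc, ← ch_add]; ring_nf

theorem invFourier_add_smul (φ ψ : C_c(ℝ, ℂ)) (c : ℂ) (y : ℝ) :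
    invFourier (φ + c • ψ) y = invFourier φ y + c * invFourier ψ y := by
  simp only [invFourier_eq]
  rw [← integral_const_mul, ← integral_add (integrable_ch_mul (integrable_cc _) (by fun_prop))
    ((integrable_ch_mul (integrable_cc _) (by fun_prop)).const_mul _)]
  congr 1; ext x
  simp; ring

theorem selfConv_apply (φ : C_c(ℝ, ℂ)) (t : ℝ) :
    selfConv φ t = ∫ s, φ s * starRingEnd ℂ (φ (s - t)) := by
  change convolution φ (fun x => starRingEnd ℂ (φ (-x))) (ContinuousLinearMap.mul ℂ ℂ) volume t = _
  simp [convolution]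

theorem selfConv_modul (φ : C_c(ℝ, ℂ)) (a t : ℝ) :
    selfConv (modul φ a) t = ch (a * t) * selfConv φ t := by
  simp only [selfConv_apply, modul_apply, map_mul, conj_ch]
  rw [← integral_const_mul]
  congr 1; ext s
  have : ch (a * t) = ch (a * s) * ch (-(a * (s - t))) := by rw [← ch_add]; ring_nf
  rw [this]; ring

theorem integrable_mul_conj (φ ψ : C_c(ℝ, ℂ)) (a b : ℝ) :
    Integrable fun s => φ (s - a) * starRingEnd ℂ (ψ (s - b)) :=
  Continuous.integrable_of_hasCompactSupport (E := ℂ) (f := fun s => trans φ a s * starRingEnd ℂ (trans ψ b s))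
    ((trans φ a).continuous.mul (Complex.continuous_conj.comp (trans ψ b).continuous))
    ((trans φ a).hasCompactSupport.mul_right)

/-- The sesquilinear expansion of a self-convolution. The fourth roots of unity c isolate a single
cross term in the polarization identity that follows. -/
theorem selfConv_add_smul_trans (φ : C_c(ℝ, ℂ)) (c : ℂ) (a t : ℝ) :
    selfConv (φ + c • trans φ a) t = (1 + c * starRingEnd ℂ c) * selfConv φ t
      + c * selfConv φ (t - a) + starRingEnd ℂ c * selfConv φ (t + a) := by
  have h1 : ∀ s, (φ + c • trans φ a) s * starRingEnd ℂ ((φ + c • trans φ a) (s - t)) =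
      φ (s - 0) * starRingEnd ℂ (φ (s - t)) +
      c * starRingEnd ℂ c * (φ (s - a) * starRingEnd ℂ (φ (s - (t + a)))) +
      c * (φ (s - a) * starRingEnd ℂ (φ (s - t))) +
      starRingEnd ℂ c * (φ (s - 0) * starRingEnd ℂ (φ (s - (t + a)))) := fun s => by
    simp [sub_sub]; ring
  have h2 : ∫ s, φ (s - a) * starRingEnd ℂ (φ (s - (t + a))) = selfConv φ t := by
    rw [selfConv_apply, ← integral_add_right_eq_self _ a]
    congr 1; ext s; congr 3 <;> ring
  have h3 : ∫ s, φ (s - a) * starRingEnd ℂ (φ (s - t)) = selfConv φ (t - a) := by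
    rw [selfConv_apply, ← integral_add_right_eq_self _ a]
    congr 1; ext s; congr 3 <;> ring
  have h4 : ∫ s, φ (s - 0) * starRingEnd ℂ (φ (s - t)) = selfConv φ t := by
    simp [selfConv_apply]
  have h5 : ∫ s, φ (s - 0) * starRingEnd ℂ (φ (s - (t + a))) = selfConv φ (t + a) := by
    simp [selfConv_apply]
  rw [selfConv_apply (φ + _)]
  simp_rw [h1]
  have i := integrable_mul_conj φ φ
  rw [integral_add, integral_add, integral_add, integral_const_mul, integral_const_mul,
    integral_const_mul, h2, h3, h4, h5]
  · ring
  · exact i _ _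
  · exact (i _ _).const_mul _
  · exact (i _ _).add ((i _ _).const_mul _)
  · exact (i _ _).const_mul _
  · exact ((i _ _).add ((i _ _).const_mul _)).add ((i _ _).const_mul _)
  · exact (i _ _).const_mul _

/-- The polarization identity for the self-convolution. -/
theorem trans_selfConv (φ : C_c(ℝ, ℂ)) (a : ℝ) :
    trans (selfConv φ) a = (1 / 4 : ℂ) • (selfConv (φ + (1 : ℂ) • trans φ a)
      - selfConv (φ + (-1 : ℂ) • trans φ a)
      + (-Complex.I) • selfConv (φ + Complex.I • trans φ a)
      + Complex.I • selfConv (φ + (-Complex.I) • trans φ a)) := by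
  ext t
  simp only [CompactlySupportedContinuousMap.coe_smul, CompactlySupportedContinuousMap.coe_add,
    CompactlySupportedContinuousMap.coe_sub, Pi.smul_apply, Pi.add_apply, Pi.sub_apply,
    smul_eq_mul, selfConv_add_smul_trans, trans_apply]
  simp only [map_neg, Complex.conj_I, map_one]
  have := Complex.I_mul_I
  linear_combination (1 / 2 * selfConv φ (t - a) - 1 / 2 * selfConv φ (t + a)) * this

/-- The scalar counterpart of `trans_selfConv`, with the same four coefficients. Together they carry
an identity for |φˇ|² over to |φˇ|² times a character. -/
theorem polarization (z w : ℂ) :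
    z * (starRingEnd ℂ w) = 1 / 4 * (((‖w + 1 * z‖ ^ 2 : ℝ) : ℂ) - ((‖w + (-1) * z‖ ^ 2 : ℝ) : ℂ)
      + (-Complex.I) * ((‖w + Complex.I * z‖ ^ 2 : ℝ) : ℂ)
      + Complex.I * ((‖w + (-Complex.I) * z‖ ^ 2 : ℝ) : ℂ)) := by
  have e : ∀ x : ℂ, ((‖x‖ ^ 2 : ℝ) : ℂ) = x * starRingEnd ℂ x := fun x => by
    rw [Complex.mul_conj, Complex.normSq_eq_norm_sq]
  simp only [e, map_add, map_mul, map_neg, Complex.conj_I, map_one]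
  have := Complex.I_mul_I
  linear_combination (1 / 2 * z * starRingEnd ℂ w - 1 / 2 * w * starRingEnd ℂ z) * this

/-! ### The Fourier transform of a self-convolution -/

/-- The convolution theorem: the transform of φ~ is the complex conjugate of that of φ. -/
theorem fourier_selfConv (φ : C_c(ℝ, ℂ)) (w : ℝ) :
    𝓕 (selfConv φ : ℝ → ℂ) w = ((‖invFourier φ (-w)‖ ^ 2 : ℝ) : ℂ) := by
  have hi : Integrable fun x => starRingEnd ℂ (φ (-x)) :=
    (Complex.conjLIE.integrable_comp_iff.2 (integrable_cc φ).comp_neg)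
  have := Real.fourier_mul_convolution_eq (integrable_cc φ) hi w
  change 𝓕 (convolution φ (fun x => starRingEnd ℂ (φ (-x))) (ContinuousLinearMap.mul ℂ ℂ) volume) w = _
  rw [this, invFourier_eq_fourier, neg_neg, ← Complex.normSq_eq_norm_sq, ← Complex.mul_conj]
  congr 1
  rw [fourier_eq_ch, fourier_eq_ch, ← integral_conj, ← integral_neg_eq_self]
  congr 1; ext v
  simp [conj_ch]

open Complex Real in
/-- An integrable function which is continuous at `0` and has a non-negative Fourier transform
has an integrable Fourier transform. -/
theorem integrable_of_fourier_nonneg {f : ℝ → ℂ} (hf : Integrable f) (h0 : ContinuousAt f 0)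
    {g : ℝ → ℝ} (hg : Continuous g) (hpos : ∀ w, 0 ≤ g w) (hfg : ∀ w, 𝓕 f w = g w) :
    Integrable g := by
  -- Gaussian summability: moving the transform from f onto the Gaussian produces an approximate
  -- identity at 0, so the regularized integrals of g converge to f 0.
  have key : Tendsto (fun c : ℝ => ∫ w : ℝ, cexp (- (c : ℂ)⁻¹ * ‖w‖ ^ 2) * (g w : ℂ)) atTop
      (𝓝 (f 0)) := by
    refine (Real.tendsto_integral_gaussian_smul' hf h0).congr' ?_
    filter_upwards [Ioi_mem_atTop 0] with c (hc : 0 < c)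
    have J : Integrable (fun w : ℝ ↦ cexp (- (c : ℂ)⁻¹ * ‖w‖ ^ 2 + 2 * π * I * inner ℝ (0 : ℝ) w)) :=
      GaussianFourier.integrable_cexp_neg_mul_sq_norm_add (by simpa) _ _
    have := (VectorFourier.integral_fourierIntegral_smul_eq_flip (L := innerₗ ℝ)
      Real.continuous_fourierChar continuous_inner J hf)
    have e1 : ∫ w : ℝ, cexp (- (c : ℂ)⁻¹ * ‖w‖ ^ 2) * (g w : ℂ) =
        ∫ w : ℝ, 𝓕 (fun w : ℝ ↦ cexp (- (c : ℂ)⁻¹ * ‖w‖ ^ 2 + 2 * π * I * inner ℝ (0 : ℝ) w)) w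
          • f w := by
      refine Eq.trans ?_ this.symm
      refine integral_congr_ae (Eventually.of_forall fun w => ?_)
      have hw : VectorFourier.fourierIntegral 𝐞 volume (innerₗ ℝ).flip f w = 𝓕 f w := by
        rw [flip_innerₗ]; rfl
      simp only [hw, hfg]; simp
    rw [e1]
    congr with w
    rw [fourier_gaussian_innerProductSpace' (by simpa)]
    simp only [div_inv_eq_mul]
    rw [mul_right_comm]
  have hn : ∀ (c w : ℝ), cexp (- (c : ℂ)⁻¹ * ‖w‖ ^ 2) * (g w : ℂ)
      = ((Real.exp (-c⁻¹ * w ^ 2) * g w : ℝ) : ℂ) := fun c w => by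
    push_cast
    congr 3
    simp [← ofReal_pow]
  have hbd : ∀ w, ‖g w‖ ≤ ∫ v, ‖f v‖ := fun w => by
    have : ‖(g w : ℂ)‖ ≤ ∫ v, ‖f v‖ := by
      rw [← hfg w, fourier_eq_ch]
      refine (norm_integral_le_integral_norm _).trans_eq ?_
      simp
    simpa using this
  have hint : ∀ c : ℝ, 0 < c → Integrable fun w => Real.exp (-c⁻¹ * w ^ 2) * g w := fun c hc =>
    (integrable_exp_neg_mul_sq (inv_pos.2 hc)).mul_bdd hg.aestronglyMeasurable
      (Eventually.of_forall hbd)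
  have key2 : Tendsto (fun n : ℕ => ∫ w : ℝ, Real.exp (-(n : ℝ)⁻¹ * w ^ 2) * g w) atTop
      (𝓝 (f 0).re) := by
    have := (Complex.continuous_re.tendsto _).comp (key.comp tendsto_natCast_atTop_atTop)
    refine this.congr fun n => ?_
    simp only [Function.comp_apply, hn]
    exact congrArg re integral_ofReal |>.trans (ofReal_re _)
  refine ⟨hg.aestronglyMeasurable, ?_⟩
  refine (hasFiniteIntegral_iff_ofReal (Eventually.of_forall hpos)).2 ?_
  have hm : ∀ n : ℕ, Measurable fun w =>
      ENNReal.ofReal (Real.exp (-(n : ℝ)⁻¹ * w ^ 2) * g w) := fun n =>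
    (ENNReal.continuous_ofReal.comp (by fun_prop)).measurable
  -- Positivity of g enters here: by Fatou, the integral of g is at most the limit of the
  -- regularized ones.
  have fatou := lintegral_liminf_le (μ := (volume : Measure ℝ)) (u := atTop) hm
  have hl : ∀ w, liminf (fun n : ℕ => ENNReal.ofReal (Real.exp (-(n : ℝ)⁻¹ * w ^ 2) * g w)) atTop
      = ENNReal.ofReal (g w) := fun w => by
    refine Tendsto.liminf_eq (ENNReal.tendsto_ofReal ?_)
    have : Tendsto (fun n : ℕ => Real.exp (-(n : ℝ)⁻¹ * w ^ 2) * g w) atTop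
        (𝓝 (Real.exp (-0 * w ^ 2) * g w)) :=
      ((Real.continuous_exp.tendsto _).comp
        ((tendsto_inv_atTop_nhds_zero_nat.neg).mul_const _)).mul_const _
    simpa using this
  simp_rw [hl] at fatou
  refine fatou.trans_lt ?_
  have hr : liminf (fun n : ℕ => ∫⁻ w, ENNReal.ofReal (Real.exp (-(n : ℝ)⁻¹ * w ^ 2) * g w)) atTop
      = ENNReal.ofReal (f 0).re := by
    refine Tendsto.liminf_eq (((ENNReal.tendsto_ofReal key2)).congr' ?_)
    filter_upwards [Ioi_mem_atTop 0] with n hn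
    refine ofReal_integral_eq_lintegral_ofReal (hint n (by exact_mod_cast hn))
      (Eventually.of_forall fun w => mul_nonneg (Real.exp_pos _).le (hpos w))
  rw [hr]
  exact ENNReal.ofReal_lt_top

theorem integrable_normSq_invFourier (φ : C_c(ℝ, ℂ)) :
    Integrable fun y => ‖invFourier φ y‖ ^ 2 := by
  have := integrable_of_fourier_nonneg (integrable_cc (selfConv φ))
    (selfConv φ).continuous.continuousAt (g := fun w => ‖invFourier φ (-w)‖ ^ 2)
    (((continuous_invFourier φ).comp continuous_neg).norm.pow 2) (fun _ => by positivity)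
    (fourier_selfConv φ)
  simpa using this.comp_neg

/-- Fourier inversion, legitimate because |φˇ|² is integrable. It exhibits a self-convolution as the
transform of a positive density. -/
theorem selfConv_eq_integral (φ : C_c(ℝ, ℂ)) (t : ℝ) :
    selfConv φ (-t) = ∫ y, ch (t * y) * ((‖invFourier φ y‖ ^ 2 : ℝ) : ℂ) := by
  have hF : (𝓕 (selfConv φ : ℝ → ℂ)) = fun w => ((‖invFourier φ (-w)‖ ^ 2 : ℝ) : ℂ) :=
    funext (fourier_selfConv φ)
  have := Continuous.fourierInv_fourier_eq (f := (selfConv φ : ℝ → ℂ)) (selfConv φ).continuous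
    (integrable_cc _) (by
    rw [hF]; exact (integrable_normSq_invFourier φ).comp_neg.ofReal)
  rw [← this, fourierInv_eq_ch, hF, ← integral_neg_eq_self]
  congr 1; ext y
  simp [mul_comm t y]

/-! ### Densities and polar decompositions -/

/-- The Radon–Nikodym derivative, truncated at 1 so that the bounds hold everywhere and not just
almost everywhere. It allows several measures to be compared over a common dominating one. -/
theorem exists_density_of_le {m M : Measure ℝ} [SigmaFinite m] [SigmaFinite M] (h : m ≤ M) :
    ∃ d : ℝ → ℝ, Measurable d ∧ (∀ x, 0 ≤ d x) ∧ (∀ x, d x ≤ 1) ∧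
      ∀ f : ℝ → ℂ, ∫ x, f x ∂m = ∫ x, d x * f x ∂M := by
  refine ⟨fun x => (min (m.rnDeriv M x) 1).toReal,
    ((Measure.measurable_rnDeriv m M).min measurable_const).ennreal_toReal,
    fun x => ENNReal.toReal_nonneg, fun x => ?_, fun f => ?_⟩
  · simpa using ENNReal.toReal_mono ENNReal.one_ne_top (min_le_right (m.rnDeriv M x) 1)
  · have h1 : M.withDensity (fun x => min (m.rnDeriv M x) 1) = m := by
      rw [withDensity_congr_ae (g := m.rnDeriv M),
        Measure.withDensity_rnDeriv_eq _ _ (Measure.absolutelyContinuous_of_le h)]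
      filter_upwards [Measure.rnDeriv_le_one_of_le h] with x hx
      exact min_eq_left hx
    conv_lhs => rw [← h1]
    rw [integral_withDensity_eq_integral_toReal_smul
      ((Measure.measurable_rnDeriv m M).min measurable_const)
      (Eventually.of_forall fun x => (min_le_right _ _).trans_lt ENNReal.one_lt_top)]
    simp

/-- With densities d, e of p, q relative to p + q, the total variation of p - q has density |d - e|
and u is the sign of d - e. Working over p + q makes sense of p - q even when both masses are
infinite. -/
theorem exists_polar (p q : Measure ℝ) [IsLocallyFiniteMeasure p] [IsLocallyFiniteMeasure q] :
    ∃ (m : Measure ℝ) (u : ℝ → ℂ), m ≤ p + q ∧ Measurable u ∧ (∀ x, ‖u x‖ = 1) ∧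
      ∀ f : ℝ → ℂ, Integrable f (p + q) → ∫ x, f x * u x ∂m = ∫ x, f x ∂p - ∫ x, f x ∂q := by
  obtain ⟨d, hd, hd0, hd1, hdi⟩ := exists_density_of_le (m := p) (M := p + q)
    (Measure.le_add_right le_rfl)
  obtain ⟨e, he, he0, he1, hei⟩ := exists_density_of_le (m := q) (M := p + q)
    (Measure.le_add_left le_rfl)
  set D : ℝ → ℝ := fun x => |d x - e x| with hD
  have hDm : Measurable D := (hd.sub he).abs
  have hD1 : ∀ x, D x ≤ 1 := fun x => abs_le.2 ⟨by linarith [hd0 x, he1 x], by linarith [hd1 x, he0 x]⟩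
  refine ⟨(p + q).withDensity fun x => ENNReal.ofReal (D x),
    fun x => if 0 ≤ d x - e x then 1 else -1, ?_, ?_, ?_, ?_⟩
  · conv_rhs => rw [← withDensity_one (μ := p + q)]
    exact withDensity_mono (Eventually.of_forall fun x => by simpa using hD1 x)
  · exact Measurable.ite (measurableSet_le measurable_const (hd.sub he)) measurable_const
      measurable_const
  · intro x; dsimp only; split_ifs <;> simp
  · intro f hf
    rw [hdi, hei, integral_withDensity_eq_integral_toReal_smul (by fun_prop) (by simp),
      ← integral_sub]
    · refine integral_congr_ae (Eventually.of_forall fun x => ?_)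
      simp only [ENNReal.toReal_ofReal (abs_nonneg _), hD, Complex.real_smul]
      split_ifs with hx
      · rw [abs_of_nonneg hx]; push_cast; ring
      · rw [abs_of_neg (not_le.1 hx)]; push_cast; ring
    · exact hf.bdd_mul (c := 1) (by fun_prop) (Eventually.of_forall fun x => by
        simpa [abs_of_nonneg (hd0 x)] using hd1 x)
    · exact hf.bdd_mul (c := 1) (by fun_prop) (Eventually.of_forall fun x => by
        simpa [abs_of_nonneg (he0 x)] using he1 x)

theorem integrable_cc' (g : C_c(ℝ, ℂ)) (m : Measure ℝ) [IsFiniteMeasureOnCompacts m] :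
    Integrable g m :=
  g.continuous.integrable_of_hasCompactSupport g.hasCompactSupport

theorem norm_integral_cc_le (m : Measure ℝ) [IsLocallyFiniteMeasure m] {K : Set ℝ}
    (hK : IsCompact K) {g : C_c(ℝ, ℂ)} {b : ℝ} (hg : tsupport g ⊆ K) (hb : ∀ x, ‖g x‖ ≤ b) :
    ‖∫ x, g x ∂m‖ ≤ m.real K * b := by
  rw [← setIntegral_eq_integral_of_forall_compl_eq_zero (s := K)
    fun x hx => image_eq_zero_of_notMem_tsupport fun h => hx (hg h), mul_comm]
  exact norm_setIntegral_le_of_norm_le_const hK.measure_lt_top fun x _ => hb x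

/-- The difference of two locally finite positive measures. -/
def diffMeasure (p q : Measure ℝ) [IsLocallyFiniteMeasure p] [IsLocallyFiniteMeasure q] :
    RadonMeasure where
  toLinearMap :=
    { toFun := fun g => ∫ x, g x ∂p - ∫ x, g x ∂q
      map_add' := fun f g => by
        simp only [CompactlySupportedContinuousMap.add_apply]
        rw [integral_add (integrable_cc' _ _) (integrable_cc' _ _),
          integral_add (integrable_cc' _ _) (integrable_cc' _ _)]
        ring
      map_smul' := fun c g => by
        simp only [CompactlySupportedContinuousMap.smul_apply, smul_eq_mul, RingHom.id_apply]
        rw [integral_const_mul, integral_const_mul]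
        ring }
  locally_bounded := fun K hK => ⟨p.real K + q.real K, fun g b hg hb => by
    rw [add_mul]
    exact (norm_sub_le _ _).trans (add_le_add (norm_integral_cc_le p hK hg hb)
      (norm_integral_cc_le q hK hg hb))⟩

theorem diffMeasure_apply (p q : Measure ℝ) [IsLocallyFiniteMeasure p] [IsLocallyFiniteMeasure q]
    (g : C_c(ℝ, ℂ)) : diffMeasure p q g = ∫ x, g x ∂p - ∫ x, g x ∂q := rfl

theorem RadonMeasure.ext' {μ ν : RadonMeasure} (h : ∀ g, μ g = ν g) : μ = ν := by
  cases μ; cases ν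
  congr 1
  exact LinearMap.ext h

/-! ### Uniqueness of the Fourier transform -/

theorem schwartz_eq_integral_ch (G : SchwartzMap ℝ ℂ) (y : ℝ) :
    G y = ∫ w, ch (w * y) * 𝓕 (G : ℝ → ℂ) w := by
  have h := Continuous.fourierInv_fourier_eq (f := (G : ℝ → ℂ)) G.continuous G.integrable (by
    rw [← SchwartzMap.fourier_coe]; exact (𝓕 G).integrable)
  rw [← fourierInv_eq_ch, h]

/-- Fubini. It is used both for uniqueness of the transform and for inserting an extra factor |ψˇ|².
-/
theorem integral_fourier_mul {M : Measure ℝ} [SFinite M] {k : ℝ → ℂ} (hk : Integrable k M)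
    {F : ℝ → ℂ} (hF : Integrable F) :
    ∫ y, (∫ w, ch (w * y) * F w) * k y ∂M = ∫ w, F w * ∫ y, ch (w * y) * k y ∂M := by
  have hp : Integrable (Function.uncurry fun w y => ch (w * y) * (F w * k y))
      (volume.prod M) :=
    (hF.mul_prod hk).bdd_mul (c := 1)
      (Continuous.aestronglyMeasurable (by fun_prop)) (Eventually.of_forall fun _ => (norm_ch _).le)
  calc ∫ y, (∫ w, ch (w * y) * F w) * k y ∂M = ∫ y, (∫ w, ch (w * y) * (F w * k y)) ∂M := by
        refine integral_congr_ae (Eventually.of_forall fun y => ?_)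
        dsimp only
        rw [← integral_mul_const]
        congr 1; ext w; ring
    _ = ∫ w, ∫ y, ch (w * y) * (F w * k y) ∂M := (integral_integral_swap hp).symm
    _ = _ := by
        congr 1; ext w
        rw [← integral_const_mul]
        congr 1; ext y; ring

/-- Uniqueness of the Fourier transform of finite complex measures. -/
theorem ae_eq_zero_of_integral_ch_eq_zero {M : Measure ℝ} [SFinite M] {k : ℝ → ℂ}
    (hk : Integrable k M) (h : ∀ w, ∫ y, ch (w * y) * k y ∂M = 0) : ∀ᵐ y ∂M, k y = 0 := by
  -- Smooth compactly supported test functions suffice, and each of them is the inverse transform of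
  -- a Schwartz function.
  refine ae_eq_zero_of_integral_contDiff_smul_eq_zero hk.locallyIntegrable fun g hg hgc => ?_
  have hgc' : HasCompactSupport fun x => (g x : ℂ) := hgc.comp_left (g := Complex.ofReal) rfl
  have hg' : ContDiff ℝ ((⊤ : ℕ∞) : WithTop ℕ∞) fun x => (g x : ℂ) := Complex.ofRealCLM.contDiff.comp hg
  have hG : Integrable (𝓕 (hgc'.toSchwartzMap hg' : ℝ → ℂ)) := by
    rw [← SchwartzMap.fourier_coe]; exact (𝓕 (hgc'.toSchwartzMap hg')).integrable
  have := integral_fourier_mul hk hG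
  simp only [h, mul_zero, integral_zero, ← schwartz_eq_integral_ch] at this
  simpa using this

/-- A bump has positive integral, which is its transform at 0; modulation moves that value to y. -/
theorem exists_invFourier_ne_zero (y : ℝ) : ∃ φ : C_c(ℝ, ℂ), invFourier φ y ≠ 0 := by
  let b : ContDiffBump (0 : ℝ) := default
  let φ : C_c(ℝ, ℂ) := ⟨⟨fun x => (b x : ℂ), Complex.continuous_ofReal.comp b.continuous⟩,
    b.hasCompactSupport.comp_left (g := Complex.ofReal) rfl⟩
  refine ⟨modul φ (-y), ?_⟩
  rw [invFourier_modul, invFourier_eq]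
  simp only [add_neg_cancel, mul_zero, ch_zero, one_mul]
  change ∫ x, ((b x : ℝ) : ℂ) ≠ 0
  rw [integral_complex_ofReal]
  exact_mod_cast b.integral_pos.ne'

theorem sq_norm_eq (z : ℂ) : ((‖z‖ ^ 2 : ℝ) : ℂ) = z * starRingEnd ℂ z := by
  rw [Complex.mul_conj, Complex.normSq_eq_norm_sq]

theorem integrable_normSq_mul {m : Measure ℝ} {u : ℝ → ℂ} (hum : Measurable u)
    (hu : ∀ x, ‖u x‖ = 1) {φ : C_c(ℝ, ℂ)} (hφ : MemLp (invFourier φ) 2 m) :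
    Integrable (fun y => normSqInvFourier φ y * u y) m :=
  (hφ.integrable_norm_pow (p := 2) two_ne_zero).ofReal.mul_bdd (c := 1) hum.aestronglyMeasurable
    (Eventually.of_forall fun x => (hu x).le)

/-- If `φˇ` is square-integrable and `μ(φ * φ~) = ∫ |φˇ|² u dm` for all `φ`, then the same holds for
translates of `φ * φ~`. -/
theorem apply_trans_selfConv {μ : RadonMeasure} {m : Measure ℝ} {u : ℝ → ℂ} (hum : Measurable u)
    (hu : ∀ x, ‖u x‖ = 1) (h : ∀ φ : C_c(ℝ, ℂ), MemLp (invFourier φ) 2 m ∧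
      μ (selfConv φ) = ∫ y, normSqInvFourier φ y * u y ∂m) (φ : C_c(ℝ, ℂ)) (a : ℝ) :
    μ (trans (selfConv φ) a) = ∫ y, ch (a * y) * (normSqInvFourier φ y * u y) ∂m := by
  have i := fun ψ => integrable_normSq_mul hum hu (h ψ).1
  rw [trans_selfConv]
  simp only [map_add, map_sub, map_smul, smul_eq_mul, (h _).2]
  have e : ∀ y, ch (a * y) * (normSqInvFourier φ y * u y) = 1 / 4 *
      (normSqInvFourier (φ + (1 : ℂ) • trans φ a) y * u y
        - normSqInvFourier (φ + (-1 : ℂ) • trans φ a) y * u y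
        + (-Complex.I) * (normSqInvFourier (φ + Complex.I • trans φ a) y * u y)
        + Complex.I * (normSqInvFourier (φ + (-Complex.I) • trans φ a) y * u y)) := fun y => by
    have := polarization (ch (a * y) * invFourier φ y) (invFourier φ y)
    rw [mul_assoc, ← sq_norm_eq] at this
    simp only [normSqInvFourier, ContinuousMap.coe_mk, invFourier_add_smul, invFourier_trans]
    rw [← mul_assoc, this]
    ring
  simp_rw [e]
  rw [integral_const_mul, integral_add, integral_add, integral_sub (i _) (i _),
    integral_const_mul, integral_const_mul]
  · exact (i _).sub (i _)
  · exact (i _).const_mul _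
  · exact ((i _).sub (i _)).add ((i _).const_mul _)
  · exact (i _).const_mul _

/-- Two measures are equal if `|φˇ|²` times them have the same Fourier transform for all `φ`. -/
theorem RadonMeasure.eq_of_integral_ch_eq {σ₁ σ₂ : RadonMeasure} {m₁ m₂ : Measure ℝ}
    {u₁ u₂ : ℝ → ℂ} (h₁ : σ₁.IsPolar m₁ u₁) (h₂ : σ₂.IsPolar m₂ u₂)
    (hi₁ : ∀ φ : C_c(ℝ, ℂ), MemLp (invFourier φ) 2 m₁)
    (hi₂ : ∀ φ : C_c(ℝ, ℂ), MemLp (invFourier φ) 2 m₂)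
    (h : ∀ (φ : C_c(ℝ, ℂ)) (a : ℝ), ∫ y, ch (a * y) * (normSqInvFourier φ y * u₁ y) ∂m₁ =
      ∫ y, ch (a * y) * (normSqInvFourier φ y * u₂ y) ∂m₂) : σ₁ = σ₂ := by
  have := h₁.locallyFinite
  have := h₂.locallyFinite
  obtain ⟨d, hd, hd0, hd1, hdi⟩ := exists_density_of_le (m := m₁) (M := m₁ + m₂)
    (Measure.le_add_right le_rfl)
  obtain ⟨e, he, he0, he1, hei⟩ := exists_density_of_le (m := m₂) (M := m₁ + m₂)
    (Measure.le_add_left le_rfl)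
  have bd : ∀ x, ‖d x * u₁ x‖ ≤ 1 := fun x => by
    simpa [h₁.norm_eq_one, abs_of_nonneg (hd0 x)] using hd1 x
  have be : ∀ x, ‖e x * u₂ x‖ ≤ 1 := fun x => by
    simpa [h₂.norm_eq_one, abs_of_nonneg (he0 x)] using he1 x
  have md : Measurable fun x => (d x : ℂ) * u₁ x := by have := h₁.measurable; fun_prop
  have me : Measurable fun x => (e x : ℂ) * u₂ x := by have := h₂.measurable; fun_prop
  have id : ∀ {f : ℝ → ℂ}, Integrable f (m₁ + m₂) →
      Integrable (fun x => f x * (d x * u₁ x)) (m₁ + m₂) := fun hf =>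
    hf.mul_bdd (c := 1) md.aestronglyMeasurable (Eventually.of_forall bd)
  have ie : ∀ {f : ℝ → ℂ}, Integrable f (m₁ + m₂) →
      Integrable (fun x => f x * (e x * u₂ x)) (m₁ + m₂) := fun hf =>
    hf.mul_bdd (c := 1) me.aestronglyMeasurable (Eventually.of_forall be)
  have hφ : ∀ φ, Integrable (normSqInvFourier φ) (m₁ + m₂) := fun φ =>
    (((hi₁ φ).integrable_norm_pow (p := 2) two_ne_zero).add_measure
      ((hi₂ φ).integrable_norm_pow (p := 2) two_ne_zero)).ofReal
  have key : ∀ φ : C_c(ℝ, ℂ), ∀ᵐ y ∂(m₁ + m₂),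
      normSqInvFourier φ y * (d y * u₁ y) - normSqInvFourier φ y * (e y * u₂ y) = 0 := fun φ => by
    refine ae_eq_zero_of_integral_ch_eq_zero ((id (hφ φ)).sub (ie (hφ φ))) fun a => ?_
    have := h φ a
    rw [hdi, hei] at this
    simp only [mul_sub]
    rw [integral_sub (integrable_ch_mul (id (hφ φ)) (by fun_prop))
      (integrable_ch_mul (ie (hφ φ)) (by fun_prop)), sub_eq_zero]
    convert this using 3 <;> ring
  -- The exceptional null set in `key` depends on φ. Near any given point one φ with φˇ ≠ 0
  -- suffices, and locally null sets are null.
  have key2 : ∀ᵐ y ∂(m₁ + m₂), (d y : ℂ) * u₁ y = e y * u₂ y := by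
    rw [ae_iff]
    refine measure_null_of_locally_null _ fun x _ => ?_
    obtain ⟨φ, hφx⟩ := exists_invFourier_ne_zero x
    refine ⟨{y | invFourier φ y ≠ 0} ∩ {y | ¬ (d y : ℂ) * u₁ y = e y * u₂ y},
      inter_mem (mem_nhdsWithin_of_mem_nhds
        ((continuous_invFourier φ).continuousAt.eventually_ne hφx)) self_mem_nhdsWithin, ?_⟩
    refine measure_mono_null ?_ (ae_iff.1 (key φ))
    rintro y ⟨hy1, hy2⟩
    simp only [Set.mem_ofPred_eq] at hy1 hy2 ⊢
    rw [← mul_sub, mul_eq_zero, sub_eq_zero, not_or]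
    exact ⟨by simpa [normSqInvFourier] using hy1, hy2⟩
  refine RadonMeasure.ext' fun g => ?_
  rw [h₁.apply_eq, h₂.apply_eq, hdi, hei]
  refine integral_congr_ae ?_
  filter_upwards [key2] with y hy
  linear_combination g y * hy

/-- By polarization, the values of μ on translates of φ * φ~ are the Fourier transform of |φˇ|²
times either candidate. -/
theorem IsFourierTransform.unique {μ σ₁ σ₂ : RadonMeasure} (h₁ : IsFourierTransform μ σ₁)
    (h₂ : IsFourierTransform μ σ₂) : σ₁ = σ₂ := by
  obtain ⟨m₁, u₁, hp₁, hf₁⟩ := h₁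
  obtain ⟨m₂, u₂, hp₂, hf₂⟩ := h₂
  refine RadonMeasure.eq_of_integral_ch_eq hp₁ hp₂ (fun φ => (hf₁ φ).1) (fun φ => (hf₂ φ).1)
    fun φ a => ?_
  rw [← apply_trans_selfConv hp₁.measurable hp₁.norm_eq_one hf₁,
    ← apply_trans_selfConv hp₂.measurable hp₂.norm_eq_one hf₂]

theorem IsFourierTransform.fourierTransform_eq {μ σ : RadonMeasure} (h : IsFourierTransform μ σ) :
    fourierTransform μ = σ := by
  have ht : FourierTransformable μ := ⟨σ, h⟩
  rw [fourierTransform, dif_pos ht]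
  exact ht.choose_spec.unique h

/-! ### Translation bounded measures -/

/-- `m` is translation bounded: the masses of the intervals `[x, x + 1]` are bounded. -/
def TranslationBounded (m : Measure ℝ) : Prop :=
  ∃ C : ENNReal, C ≠ ⊤ ∧ ∀ x : ℝ, m (Set.Icc x (x + 1)) ≤ C

theorem TranslationBounded.mono {m m' : Measure ℝ} (h : TranslationBounded m) (hle : m' ≤ m) :
    TranslationBounded m' := by
  obtain ⟨C, hC, hb⟩ := h
  exact ⟨C, hC, fun x => (hle _).trans (hb x)⟩

theorem TranslationBounded.add {m m' : Measure ℝ} (h : TranslationBounded m)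
    (h' : TranslationBounded m') : TranslationBounded (m + m') := by
  obtain ⟨C, hC, hb⟩ := h
  obtain ⟨C', hC', hb'⟩ := h'
  exact ⟨C + C', ENNReal.add_ne_top.2 ⟨hC, hC'⟩, fun x => add_le_add (hb x) (hb' x)⟩

theorem TranslationBounded.isLocallyFinite {m : Measure ℝ} (h : TranslationBounded m) :
    IsLocallyFiniteMeasure m := by
  obtain ⟨C, hC, hb⟩ := h
  refine ⟨fun x => ⟨Set.Icc (x - 1 / 2) (x - 1 / 2 + 1),
    Icc_mem_nhds (by linarith) (by linarith), (hb _).trans_lt hC.lt_top⟩⟩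

theorem sinc_ge_half {t : ℝ} (ht : |t| ≤ 1) : 1 / 2 ≤ Real.sinc t := by
  rcases eq_or_ne t 0 with rfl | h0
  · norm_num
  have key : ∀ s : ℝ, 0 < s → s ≤ 1 → 1 / 2 ≤ Real.sinc s := fun s hs hs1 => by
    rw [Real.sinc_of_ne_zero hs.ne', le_div_iff₀ hs]
    have := Real.sin_gt_sub_cube hs
    nlinarith [mul_pos hs hs]
  rcases lt_or_gt_of_ne h0 with h | h
  · rw [← Real.sinc_neg]
    exact key _ (by linarith) (by rw [abs_of_neg h] at ht; exact ht)
  · exact key _ h (by rw [abs_of_pos h] at ht; exact ht)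

/-- The Fourier transform of the indicator function of an interval. -/
theorem integral_ch_interval (a x : ℝ) :
    ∫ v in (-a)..a, ch (v * x) = ((2 * a * Real.sinc (2 * Real.pi * a * x) : ℝ) : ℂ) := by
  rcases eq_or_ne x 0 with rfl | hx
  · simp; ring
  rcases eq_or_ne a 0 with rfl | ha
  · simp
  have hp := Real.pi_ne_zero
  have hc : 2 * (Real.pi : ℂ) * Complex.I * x ≠ 0 := by
    simp [hp, hx, Complex.I_ne_zero]
  have h1 : ∀ v : ℝ, ch (v * x) = Complex.exp ((2 * Real.pi * Complex.I * x) * v) := fun v => by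
    rw [ch]; congr 1; push_cast; ring
  simp_rw [h1]
  rw [integral_exp_mul_complex hc, Real.sinc_of_ne_zero (by positivity)]
  rw [div_eq_iff hc]
  push_cast
  rw [Complex.sin]
  have e1 : 2 * (Real.pi : ℂ) * Complex.I * x * a = 2 * Real.pi * a * x * Complex.I := by ring
  have e2 : 2 * (Real.pi : ℂ) * Complex.I * x * -a = -(2 * Real.pi * a * x) * Complex.I := by ring
  rw [e1, e2]
  have hp' : (Real.pi : ℂ) ≠ 0 := by exact_mod_cast hp
  have hx' : (x : ℂ) ≠ 0 := by exact_mod_cast hx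
  have ha' : (a : ℂ) ≠ 0 := by exact_mod_cast ha
  field_simp
  have := Complex.I_sq
  linear_combination (Complex.exp (2 * Real.pi * a * x * Complex.I) -
    Complex.exp (-(2 * Real.pi * a * x * Complex.I))) * this

/-- Every inverse Fourier transform is an average of another one over a small interval. -/
theorem exists_average (φ : C_c(ℝ, ℂ)) : ∃ (θ : C_c(ℝ, ℂ)) (δ : ℝ), 0 < δ ∧ δ ≤ 1 / 2 ∧
    -- Averaging θˇ over [y - δ, y + δ] multiplies θ by sinc(2πδx), so θ has to be φ divided by that
    -- function. The radius δ is chosen so small that |2πδx| ≤ 1 on the support of φ, where the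
    -- divisor is at least 1/2.
    ∀ y, invFourier φ y = (1 / (2 * δ) : ℝ) * ∫ v in (-δ)..δ, invFourier θ (y + v) := by
  obtain ⟨R, hR⟩ := φ.hasCompactSupport.isCompact.isBounded.exists_norm_le
  set δ : ℝ := 1 / (2 * Real.pi * (|R| + 1)) with hδ
  have hpi := Real.pi_gt_three
  have hδ0 : 0 < δ := by positivity
  have hδ1 : δ ≤ 1 / 2 := by
    rw [hδ]
    refine one_div_le_one_div_of_le (by norm_num) ?_
    nlinarith [abs_nonneg R]
  -- The truncation at 1/2 keeps the divisor away from 0 everywhere and changes nothing on the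
  -- support of φ.
  let s : ℝ → ℝ := fun x => max (Real.sinc (2 * Real.pi * δ * x)) (1 / 2)
  have hs : ∀ x, s x ≠ 0 := fun x => by have : 1 / 2 ≤ s x := le_max_right _ _; positivity
  have hsc : Continuous s := (Real.continuous_sinc.comp (by fun_prop)).max continuous_const
  let θ : C_c(ℝ, ℂ) := (⟨fun x => ((s x)⁻¹ : ℂ),
    (Complex.continuous_ofReal.comp hsc).inv₀ fun x => Complex.ofReal_ne_zero.2 (hs x)⟩ : C(ℝ, ℂ)) • φ
  have hθ : ∀ x, θ x * ((Real.sinc (2 * Real.pi * δ * x) : ℝ) : ℂ) = φ x := fun x => by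
    have e : θ x = (s x : ℂ)⁻¹ * φ x := by simp [θ]
    by_cases hx : x ∈ tsupport φ
    · have h1 : |2 * Real.pi * δ * x| ≤ 1 := by
        have h2 : |x| ≤ |R| + 1 := by
          have := hR x hx; rw [Real.norm_eq_abs] at this; linarith [le_abs_self R]
        rw [abs_mul, abs_of_pos (by positivity), hδ]
        have : 2 * Real.pi * (1 / (2 * Real.pi * (|R| + 1))) = 1 / (|R| + 1) := by field_simp
        rw [this, div_mul_eq_mul_div, one_mul, div_le_one (by positivity)]
        exact h2
      have h3 : s x = Real.sinc (2 * Real.pi * δ * x) := max_eq_left (sinc_ge_half h1)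
      rw [e, ← h3]
      have : (s x : ℂ) ≠ 0 := by exact_mod_cast hs x
      field_simp
    · rw [e, image_eq_zero_of_notMem_tsupport hx]; simp
  refine ⟨θ, δ, hδ0, hδ1, fun y => ?_⟩
  have hi : Integrable (Function.uncurry fun v x => ch (x * (y + v)) * (1 * θ x))
      ((volume.restrict (Set.Ioc (-δ) δ)).prod volume) :=
    ((integrable_const (1 : ℂ)).mul_prod (integrable_cc θ)).bdd_mul (c := 1)
      (Continuous.aestronglyMeasurable (by fun_prop)) (Eventually.of_forall fun _ => (norm_ch _).le)
  simp only [invFourier_eq]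
  have h1 : ∫ v in (-δ)..δ, ∫ x, ch (x * (y + v)) * θ x =
      ∫ x, ∫ v in (-δ)..δ, ch (x * (y + v)) * θ x := by
    simp only [intervalIntegral.integral_of_le (neg_le_self hδ0.le)]
    simp only [one_mul] at hi
    exact integral_integral_swap hi
  rw [h1, ← integral_const_mul]
  refine integral_congr_ae (Eventually.of_forall fun x => ?_)
  dsimp only
  have h2 : ∀ v, ch (x * (y + v)) * θ x = ch (x * y) * θ x * ch (v * x) := fun v => by
    rw [mul_add, ch_add, mul_comm v]; ring
  simp_rw [h2]
  rw [intervalIntegral.integral_const_mul, integral_ch_interval, ← hθ x]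
  have : (δ : ℂ) ≠ 0 := by exact_mod_cast hδ0.ne'
  push_cast
  field_simp

/-- Cauchy–Schwarz, from integrating the square of f minus its mean. -/
theorem sq_integral_le {f : ℝ → ℝ} (hf : Continuous f) {δ : ℝ} (hδ : 0 < δ) :
    (∫ v in (-δ)..δ, f v) ^ 2 ≤ 2 * δ * ∫ v in (-δ)..δ, f v ^ 2 := by
  set A := ∫ v in (-δ)..δ, f v
  have h : ∫ v in (-δ)..δ, (2 * (A / (2 * δ)) * f v) ≤
      ∫ v in (-δ)..δ, (f v ^ 2 + (A / (2 * δ)) ^ 2) := by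
    refine intervalIntegral.integral_mono_on (by linarith)
      (Continuous.intervalIntegrable (by fun_prop) _ _)
      (Continuous.intervalIntegrable (by fun_prop) _ _) fun v _ => ?_
    nlinarith [sq_nonneg (f v - A / (2 * δ))]
  rw [intervalIntegral.integral_const_mul, intervalIntegral.integral_add
    (Continuous.intervalIntegrable (by fun_prop) _ _)
    (Continuous.intervalIntegrable (by fun_prop) _ _), intervalIntegral.integral_const] at h
  have e : (δ - -δ) • (A / (2 * δ)) ^ 2 = A ^ 2 / (2 * δ) := by
    rw [smul_eq_mul]; field_simp; ring
  have e2 : 2 * (A / (2 * δ)) * A = 2 * (A ^ 2 / (2 * δ)) := by ring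
  have h3 : A ^ 2 / (2 * δ) ≤ ∫ v in (-δ)..δ, f v ^ 2 := by
    rw [e] at h
    change 2 * (A / (2 * δ)) * A ≤ _ at h
    linarith
  rw [div_le_iff₀ (by positivity)] at h3
  linarith

/-- Inverse Fourier transforms are square-integrable for translation bounded measures. -/
theorem TranslationBounded.memLp {m : Measure ℝ} (h : TranslationBounded m) (φ : C_c(ℝ, ℂ)) :
    MemLp (invFourier φ) 2 m := by
  have := h.isLocallyFinite
  obtain ⟨C, hC, hb⟩ := h
  obtain ⟨θ, δ, hδ0, hδ1, hθ⟩ := exists_average φ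
  set F : ℝ → ENNReal := fun w => ENNReal.ofReal (‖invFourier θ w‖ ^ 2) with hF
  have hFc : Continuous F := ENNReal.continuous_ofReal.comp ((continuous_invFourier θ).norm.pow 2)
  -- |φˇ(y)|² is at most the average of |θˇ|² near y. Integrating over y and applying Tonelli
  -- replaces the indicator by the m-mass of an interval of length 2δ ≤ 1, leaving the Lebesgue
  -- integral of |θˇ|², which is finite.
  have hpt : ∀ y, ENNReal.ofReal (‖invFourier φ y‖ ^ 2) ≤ ENNReal.ofReal (1 / (2 * δ)) *
      ∫⁻ w, (Set.Icc (w - δ) (w + δ)).indicator 1 y * F w := fun y => by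
    have hc : Continuous fun v => ‖invFourier θ (y + v)‖ :=
      ((continuous_invFourier θ).comp (by fun_prop)).norm
    have h1 : ‖invFourier φ y‖ ^ 2 ≤ 1 / (2 * δ) * ∫ v in (-δ)..δ, ‖invFourier θ (y + v)‖ ^ 2 := by
      rw [hθ, norm_mul, mul_pow, Complex.norm_real, Real.norm_of_nonneg (by positivity)]
      have h2 := intervalIntegral.norm_integral_le_integral_norm (μ := volume)
        (f := fun v => invFourier θ (y + v)) (neg_le_self hδ0.le)
      have h3 := (pow_le_pow_left₀ (norm_nonneg _) h2 2).trans (sq_integral_le hc hδ0)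
      calc _ ≤ (1 / (2 * δ)) ^ 2 * (2 * δ * ∫ v in (-δ)..δ, ‖invFourier θ (y + v)‖ ^ 2) :=
            mul_le_mul_of_nonneg_left h3 (by positivity)
        _ = _ := by field_simp
    have hio : IntegrableOn (fun v => ‖invFourier θ (y + v)‖ ^ 2) (Set.Ioc (-δ) δ) :=
      (hc.pow 2).integrableOn_Icc.mono_set Set.Ioc_subset_Icc_self
    refine (ENNReal.ofReal_le_ofReal h1).trans ?_
    rw [ENNReal.ofReal_mul (by positivity)]
    gcongr
    rw [intervalIntegral.integral_of_le (neg_le_self hδ0.le),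
      ofReal_integral_eq_lintegral_ofReal hio
        (Eventually.of_forall fun _ => by positivity), ← lintegral_indicator measurableSet_Ioc,
      ← lintegral_add_left_eq_self
        (fun w => (Set.Icc (w - δ) (w + δ)).indicator 1 y * F w) y]
    refine lintegral_mono fun v => ?_
    by_cases hv : v ∈ Set.Ioc (-δ) δ
    · rw [Set.indicator_of_mem hv, Set.indicator_of_mem (by constructor <;> linarith [hv.1, hv.2])]
      simp [hF]
    · rw [Set.indicator_of_notMem hv]; exact zero_le
  have hmeas : Measurable (Function.uncurry fun y w : ℝ =>
      (Set.Icc (w - δ) (w + δ)).indicator (1 : ℝ → ENNReal) y * F w) := by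
    refine Measurable.mul ?_ (hFc.measurable.comp measurable_snd)
    have : (Function.uncurry fun y w : ℝ => (Set.Icc (w - δ) (w + δ)).indicator (1 : ℝ → ENNReal) y)
        = {p : ℝ × ℝ | p.2 - δ ≤ p.1 ∧ p.1 ≤ p.2 + δ}.indicator 1 := by
      ext ⟨y, w⟩; rfl
    change Measurable (Function.uncurry fun y w : ℝ =>
      (Set.Icc (w - δ) (w + δ)).indicator (1 : ℝ → ENNReal) y)
    rw [this]
    refine measurable_one.indicator ?_
    exact (measurableSet_le (measurable_snd.sub_const δ) measurable_fst).inter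
      (measurableSet_le measurable_fst (measurable_snd.add_const δ))
  refine (memLp_two_iff_integrable_sq_norm (continuous_invFourier φ).aestronglyMeasurable).2
    ⟨((continuous_invFourier φ).norm.pow 2).aestronglyMeasurable, ?_⟩
  refine (hasFiniteIntegral_iff_ofReal (Eventually.of_forall fun _ => by positivity)).2 ?_
  calc ∫⁻ y, ENNReal.ofReal (‖invFourier φ y‖ ^ 2) ∂m
      ≤ ∫⁻ y, (ENNReal.ofReal (1 / (2 * δ)) *
        ∫⁻ w, (Set.Icc (w - δ) (w + δ)).indicator 1 y * F w) ∂m := lintegral_mono hpt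
    _ = ENNReal.ofReal (1 / (2 * δ)) *
        ∫⁻ w, (∫⁻ y, (Set.Icc (w - δ) (w + δ)).indicator 1 y * F w ∂m) := by
      rw [lintegral_const_mul _ (Measurable.lintegral_prod_right hmeas),
        lintegral_lintegral_swap hmeas.aemeasurable]
    _ ≤ ENNReal.ofReal (1 / (2 * δ)) * ∫⁻ w, C * F w := by
      gcongr with w
      rw [lintegral_mul_const _ (measurable_one.indicator measurableSet_Icc),
        lintegral_indicator_one measurableSet_Icc]
      gcongr
      refine (measure_mono (Set.Icc_subset_Icc_right ?_)).trans (hb _)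
      linarith
    _ < ⊤ := by
      rw [lintegral_const_mul _ hFc.measurable]
      refine ENNReal.mul_lt_top ENNReal.ofReal_lt_top (ENNReal.mul_lt_top hC.lt_top ?_)
      exact (hasFiniteIntegral_iff_ofReal (Eventually.of_forall fun _ => by positivity)).1
        (integrable_normSq_invFourier θ).2

/-- A formula for `μ(φ * φ~)` in terms of two positive translation bounded measures yields the
Fourier transform of `μ`. -/
theorem isFourierTransform_diffMeasure {μ : RadonMeasure} {p q : Measure ℝ}
    [IsLocallyFiniteMeasure p] [IsLocallyFiniteMeasure q] (hp : TranslationBounded p)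
    (hq : TranslationBounded q) (h : ∀ φ : C_c(ℝ, ℂ), μ (selfConv φ) =
      ∫ y, normSqInvFourier φ y ∂p - ∫ y, normSqInvFourier φ y ∂q) :
    IsFourierTransform μ (diffMeasure p q) := by
  obtain ⟨m, u, hle, hum, hu, hpq⟩ := exists_polar p q
  have := (hp.add hq).isLocallyFinite
  have ht := (hp.add hq).mono hle
  refine ⟨m, u, ⟨ht.isLocallyFinite, hum, hu, fun g => ?_⟩, fun φ => ⟨ht.memLp φ, ?_⟩⟩
  · rw [hpq _ (integrable_cc' g _), diffMeasure_apply]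
  · rw [h, hpq]
    exact (((hp.add hq).memLp φ).integrable_norm_pow (p := 2) two_ne_zero).ofReal

/-! ### Lévy's theorem for finite measures -/

theorem integral_ch_eq_charFun (m : Measure ℝ) (t : ℝ) :
    ∫ y, ch (t * y) ∂m = charFun m (2 * Real.pi * t) := by
  rw [charFun_apply_real]
  congr 1; ext y
  rw [ch]; congr 1; push_cast; ring

theorem norm_integral_ch_le (m : Measure ℝ) (t : ℝ) : ‖∫ y, ch (t * y) ∂m‖ ≤ m.real Set.univ := by
  rw [integral_ch_eq_charFun]
  exact norm_charFun_le _

/-- Continuity of the limit at 0 forces tightness, so the sequence has a weak cluster point, whose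
characteristic function must be f. -/
theorem exists_probabilityMeasure_of_tendsto_charFun (P : ℕ → ProbabilityMeasure ℝ) {f : ℝ → ℂ}
    (hf : ContinuousAt f 0) (h : ∀ t, Tendsto (fun n => charFun (P n : Measure ℝ) t) atTop (𝓝 (f t))) :
    ∃ Q : ProbabilityMeasure ℝ, ∀ t, charFun (Q : Measure ℝ) t = f t := by
  have ht : IsTightMeasureSet {((μ : ProbabilityMeasure ℝ) : Measure ℝ) | μ ∈ Set.range P} := by
    convert isTightMeasureSet_of_tendsto_charFun hf h using 1
    ext m; simp
  obtain ⟨Q, -, hQ⟩ := (isCompact_closure_of_isTightMeasureSet ht).exists_mapClusterPt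
    (f := atTop) (u := P) (Filter.le_principal_iff.2 (Filter.mem_map.2
      (Eventually.of_forall fun n => subset_closure ⟨n, rfl⟩)))
  refine ⟨Q, fun t => ?_⟩
  have hc : ContinuousAt (fun R : ProbabilityMeasure ℝ => charFun (R : Measure ℝ) t) Q := by
    have := ProbabilityMeasure.tendsto_iff_forall_integral_rclike_tendsto (Ω := ℝ) ℂ
      (μs := fun R : ProbabilityMeasure ℝ => R) (F := 𝓝 Q) (μ := Q)
    have h2 := this.1 tendsto_id (BoundedContinuousFunction.innerProbChar t)
    simpa only [ContinuousAt, charFun_eq_integral_innerProbChar] using h2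
  have h1 := hQ.continuousAt_comp hc
  have h2 : MapClusterPt (charFun (Q : Measure ℝ) t) atTop fun n => charFun (P n : Measure ℝ) t := h1
  have h3 : ClusterPt (charFun (Q : Measure ℝ) t) (𝓝 (f t)) := ClusterPt.mono h2 (h t)
  exact eq_of_nhds_neBot h3

/-- A continuous pointwise limit of Fourier transforms of finite positive measures is the Fourier
transform of a finite positive measure. -/
theorem exists_measure_of_tendsto (m : ℕ → Measure ℝ) [∀ n, IsFiniteMeasure (m n)] {F : ℝ → ℂ}
    (hF : Continuous F) (h : ∀ t, Tendsto (fun n => ∫ y, ch (t * y) ∂(m n)) atTop (𝓝 (F t))) :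
    ∃ ν : Measure ℝ, IsFiniteMeasure ν ∧ ∀ t, ∫ y, ch (t * y) ∂ν = F t := by
  have hmass : ∀ n, ∫ y, ch (0 * y) ∂(m n) = (m n).real Set.univ := fun n => by simp
  have hT : Tendsto (fun n => (m n).real Set.univ) atTop (𝓝 ‖F 0‖) := by
    have := (h 0).norm
    simp only [hmass] at this
    simpa [abs_of_nonneg measureReal_nonneg] using this
  have hF0 : F 0 = (‖F 0‖ : ℝ) := by
    have h1 := h 0
    simp only [hmass] at h1
    exact tendsto_nhds_unique h1 ((Complex.continuous_ofReal.tendsto _).comp hT)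
  -- F 0 is the limit of the total masses. If it is 0 then all transforms tend to 0; otherwise the
  -- measures can eventually be normalized to probabilities.
  rcases eq_or_ne (F 0) 0 with h0 | h0
  · refine ⟨0, inferInstance, fun t => ?_⟩
    rw [integral_zero_measure]
    rw [h0, norm_zero] at hT
    exact (tendsto_nhds_unique (h t)
      (squeeze_zero_norm (fun n => norm_integral_ch_le (m n) t) hT)).symm
  · have hpos : 0 < ‖F 0‖ := norm_pos_iff.2 h0
    obtain ⟨N, hN⟩ := eventually_atTop.1 (hT.eventually (lt_mem_nhds hpos))
    have hne : ∀ n, m (n + N) ≠ 0 := fun n hz => by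
      have := hN (n + N) (by omega)
      rw [hz] at this; simp at this
    have : ∀ n, NeZero (m (n + N)) := fun n => ⟨hne n⟩
    let P : ℕ → ProbabilityMeasure ℝ := fun n =>
      ⟨((m (n + N)) Set.univ)⁻¹ • m (n + N), isProbabilityMeasureSMul⟩
    obtain ⟨Q, hQ⟩ := exists_probabilityMeasure_of_tendsto_charFun P
      -- The division by 2π converts between the characters exp(2πi t y) and the convention of
      -- `charFun`.
      (f := fun t => F (t / (2 * Real.pi)) / F 0)
      ((hF.comp (by fun_prop)).div_const _).continuousAt fun t => by
        have h1 := ((h (t / (2 * Real.pi))).comp (tendsto_add_atTop_nat N)).div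
          ((h 0).comp (tendsto_add_atTop_nat N)) h0
        refine h1.congr fun n => ?_
        have e : 2 * Real.pi * (t / (2 * Real.pi)) = t := by
          have := Real.pi_ne_zero; field_simp
        simp only [Pi.div_apply, Function.comp_apply, hmass, P, ProbabilityMeasure.coe_mk,
          integral_ch_eq_charFun, e]
        rw [charFun_apply, charFun_apply, integral_smul_measure, ENNReal.toReal_inv,
          Complex.real_smul, Measure.real]
        push_cast
        rw [div_eq_inv_mul]
    refine ⟨ENNReal.ofReal ‖F 0‖ • (Q : Measure ℝ), Measure.smul_finite _ ENNReal.ofReal_ne_top, fun t => ?_⟩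
    rw [integral_smul_measure, integral_ch_eq_charFun, hQ, ENNReal.toReal_ofReal (norm_nonneg _),
      Complex.real_smul, ← hF0]
    have e : 2 * Real.pi * t / (2 * Real.pi) = t := by
      have := Real.pi_ne_zero; field_simp
    rw [e]
    field_simp

/-! ### The window function -/

theorem box_apply (a x : ℝ) : box a x = (Set.Icc (-a) a).indicator (fun _ => 1) x := rfl

theorem integrable_box (a : ℝ) : Integrable (box a) :=
  (integrable_indicator_iff measurableSet_Icc).2 (integrableOn_const (by simp))

theorem conv_box {f : ℝ → ℝ} {a : ℝ} (ha : 0 ≤ a) (x : ℝ) :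
    conv f (box a) x = ∫ t in (x - a)..(x + a), f t := by
  rw [intervalIntegral.integral_of_le (by linarith), ← integral_Icc_eq_integral_Ioc,
    ← integral_indicator measurableSet_Icc]
  change convolution f (box a) (ContinuousLinearMap.mul ℝ ℝ) volume x = _
  rw [convolution_def]
  congr 1; ext t
  simp only [ContinuousLinearMap.mul_apply', box_apply, Set.indicator_apply, Set.mem_Icc]
  by_cases h : x - a ≤ t ∧ t ≤ x + a
  · rw [if_pos h, if_pos (by constructor <;> linarith [h.1, h.2]), mul_one]
  · rw [if_neg h, if_neg (fun h' => h (by constructor <;> linarith [h'.1, h'.2])), mul_zero]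

/-- An integrable function which equals `c` on `[-b, b]` and vanishes outside `[-B, B]`. -/
structure IsPlateau (f : ℝ → ℝ) (c b B : ℝ) : Prop where
  integrable : Integrable f
  eq_const : ∀ t, |t| ≤ b → f t = c
  eq_zero : ∀ t, B < |t| → f t = 0

theorem isPlateau_box (a : ℝ) : IsPlateau (box a) 1 a a where
  integrable := integrable_box a
  eq_const t ht := by
    rw [box_apply, Set.indicator_of_mem (Set.mem_Icc.2 (abs_le.1 ht))]
  eq_zero t ht := by
    rw [box_apply, Set.indicator_of_notMem fun h => absurd (abs_le.2 (Set.mem_Icc.1 h)) (not_le.2 ht)]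

theorem IsPlateau.continuous_conv {f : ℝ → ℝ} {c b B : ℝ} (h : IsPlateau f c b B) {a : ℝ}
    (ha : 0 ≤ a) : Continuous (conv f (box a)) := by
  have e : conv f (box a) =
      fun x => (∫ t in (0 : ℝ)..(x + a), f t) - ∫ t in (0 : ℝ)..(x - a), f t := by
    ext x
    rw [conv_box ha, intervalIntegral.integral_interval_sub_left] <;>
      exact h.integrable.intervalIntegrable
  have hp := intervalIntegral.continuous_primitive
    (fun _ _ => h.integrable.intervalIntegrable (μ := volume)) (0 : ℝ)
  rw [e]
  exact (hp.comp (continuous_id.add continuous_const)).sub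
    (hp.comp (continuous_id.sub continuous_const))

/-- The convolution at t integrates f over [t - a, t + a], so the plateau shrinks by a, the support
radius grows by a, and the height is multiplied by 2a. -/
theorem IsPlateau.conv {f : ℝ → ℝ} {c b B : ℝ} (h : IsPlateau f c b B) {a : ℝ} (ha : 0 ≤ a) :
    IsPlateau (conv f (box a)) (2 * a * c) (b - a) (B + a) := by
  have hz : ∀ t, B + a < |t| → FibPingPong.conv f (box a) t = 0 := fun t ht => by
    rw [conv_box ha, intervalIntegral.integral_of_le (by linarith)]
    refine setIntegral_eq_zero_of_forall_eq_zero fun s hs => h.eq_zero s ?_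
    rcases le_total 0 t with h0 | h0
    · rw [abs_of_nonneg h0] at ht; exact lt_of_lt_of_le (by linarith [hs.1]) (le_abs_self s)
    · rw [abs_of_nonpos h0] at ht; exact lt_of_lt_of_le (by linarith [hs.2]) (neg_le_abs s)
  refine ⟨?_, fun t ht => ?_, hz⟩
  · refine (h.continuous_conv ha).integrable_of_hasCompactSupport
      (HasCompactSupport.intro (isCompact_Icc (a := -(B + a)) (b := B + a)) fun t ht => hz t ?_)
    by_contra hn
    exact ht (abs_le.1 (not_lt.1 hn))
  · rw [conv_box ha]
    have hc : ∫ s in (t - a)..(t + a), f s = ∫ s in (t - a)..(t + a), c := by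
      refine intervalIntegral.integral_congr fun s hs => h.eq_const s ?_
      rw [Set.uIcc_of_le (by linarith)] at hs
      have := abs_le.1 ht
      exact abs_le.2 ⟨by linarith [hs.1], by linarith [hs.2]⟩
    rw [hc, intervalIntegral.integral_const, smul_eq_mul]
    ring

theorem isPlateau_h_aux : IsPlateau (conv (conv (conv (box (Real.goldenRatio + 1)) (box (1 / 3)))
    (box (1 / 3))) (box (1 / 3))) (8 / 27) Real.goldenRatio (Real.goldenRatio + 2) := by
  convert (((isPlateau_box (Real.goldenRatio + 1)).conv (a := 1 / 3) (by norm_num)).conv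
    (a := 1 / 3) (by norm_num)).conv (a := 1 / 3) (by norm_num) using 1 <;> ring

theorem continuous_h : Continuous h :=
  continuous_const.mul ((((isPlateau_box (Real.goldenRatio + 1)).conv (a := 1 / 3)
    (by norm_num)).conv (a := 1 / 3) (by norm_num)).continuous_conv (by norm_num))

/-- Three convolutions with boxes of radius 1/3 shrink the plateau from τ + 1 to τ and scale it by
8/27, which the prefactor 27/8 undoes. The radius τ is what the differences of Fib require. -/
theorem h_eq_one {t : ℝ} (ht : |t| ≤ Real.goldenRatio) : h t = 1 := by
  rw [h, isPlateau_h_aux.eq_const t ht]; norm_num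

theorem h_eq_zero {t : ℝ} (ht : Real.goldenRatio + 2 < |t|) : h t = 0 := by
  rw [h, isPlateau_h_aux.eq_zero t ht]; norm_num

/-- The window function as an element of `C_c(ℝ)`. -/
def hc : C_c(ℝ, ℂ) where
  toFun t := (h t : ℂ)
  hasCompactSupport' := by
    refine HasCompactSupport.intro (isCompact_Icc (a := -(Real.goldenRatio + 2))
      (b := Real.goldenRatio + 2)) fun t ht => ?_
    rw [h_eq_zero, Complex.ofReal_zero]
    by_contra hn
    exact ht (abs_le.1 (not_lt.1 hn))
  continuous_toFun := Complex.continuous_ofReal.comp continuous_h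

theorem hc_apply (t : ℝ) : hc t = (h t : ℂ) := rfl

theorem integral_ch_box {a : ℝ} (ha : 0 ≤ a) (y : ℝ) :
    ∫ x, ch (x * y) * (box a x : ℂ) = ((2 * a * Real.sinc (2 * Real.pi * a * y) : ℝ) : ℂ) := by
  rw [← integral_ch_interval, intervalIntegral.integral_of_le (by linarith),
    ← integral_Icc_eq_integral_Ioc, ← integral_indicator measurableSet_Icc]
  congr 1; ext x
  rw [box_apply]
  by_cases hx : x ∈ Set.Icc (-a) a <;> simp [hx]

theorem integral_ch_conv {f g : ℝ → ℝ} (hf : Integrable f) (hg : Integrable g) (y : ℝ) :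
    ∫ x, ch (x * y) * (conv f g x : ℂ) =
      (∫ x, ch (x * y) * (f x : ℂ)) * ∫ x, ch (x * y) * (g x : ℂ) := by
  have e : ∀ f : ℝ → ℂ, ∫ x, ch (x * y) * f x = 𝓕 f (-y) := fun f => by
    rw [fourier_eq_ch]; simp
  simp only [e]
  have key := Real.fourier_mul_convolution_eq (hf.ofReal (𝕜 := ℂ)) (hg.ofReal (𝕜 := ℂ)) (-y)
  refine Eq.trans (congrArg (fun F : ℝ → ℂ => 𝓕 F (-y)) (funext fun x => ?_)) key
  change ((convolution f g (ContinuousLinearMap.mul ℝ ℝ) volume x : ℝ) : ℂ) = _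
  rw [convolution_def, convolution_def, ← integral_complex_ofReal]
  simp

/-- A product of four sinc factors. The √5 will cancel against the inverse covolume in Poisson
summation. -/
theorem invFourier_hc (y : ℝ) : invFourier hc y = ((√5 * omegaHatWeight y : ℝ) : ℂ) := by
  have h1 := isPlateau_box (Real.goldenRatio + 1)
  have h2 := h1.conv (a := 1 / 3) (by norm_num)
  have h3 := h2.conv (a := 1 / 3) (by norm_num)
  have hb := integrable_box (1 / 3)
  have e : ∀ x : ℝ, ch (x * y) * hc x = 27 / 8 * (ch (x * y) * (conv (conv (conv
      (box (Real.goldenRatio + 1)) (box (1 / 3))) (box (1 / 3))) (box (1 / 3)) x : ℂ)) := fun x => by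
    rw [hc_apply, h]; push_cast; ring
  rw [invFourier_eq]
  simp_rw [e]
  rw [integral_const_mul, integral_ch_conv h3.integrable hb, integral_ch_conv h2.integrable hb,
    integral_ch_conv h1.integrable hb,
    integral_ch_box (by have := Real.goldenRatio_pos; linarith), integral_ch_box (by norm_num)]
  have e2 : 2 * Real.pi * (1 / 3) * y = 2 * Real.pi / 3 * y := by ring
  have e3 : √5 * omegaHatWeight y = 27 / 8 * (2 * (Real.goldenRatio + 1) *
      Real.sinc (2 * Real.pi * (Real.goldenRatio + 1) * y) * (2 * (1 / 3) *
      Real.sinc (2 * Real.pi / 3 * y)) ^ 3) := by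
    have : 2 * (Real.goldenRatio + 1) = 3 + √5 := by rw [Real.goldenRatio]; ring
    rw [omegaHatWeight, this]
    have h5 : √5 ≠ 0 := by positivity
    field_simp
    ring
  rw [e2, e3]
  push_cast
  ring

theorem sq_sinc_le (t : ℝ) : Real.sinc t ^ 2 ≤ 2 / (1 + t ^ 2) := by
  rw [le_div_iff₀ (by positivity)]
  have h1 : Real.sinc t ^ 2 ≤ 1 := (sq_le_one_iff_abs_le_one _).2 (Real.abs_sinc_le_one t)
  have h2 : Real.sinc t ^ 2 * t ^ 2 ≤ 1 := by
    rcases eq_or_ne t 0 with rfl | h0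
    · simp
    · rw [Real.sinc_of_ne_zero h0, div_pow, div_mul_cancel₀ _ (pow_ne_zero 2 h0)]
      exact Real.sin_sq_le_one t
  linarith

/-- Two of the three factors sinc(2πt/3) already give quadratic decay; the remaining factors are
bounded by 1. -/
theorem abs_omegaHatWeight_le (t : ℝ) :
    |omegaHatWeight t| ≤ (3 + √5) / √5 * 2 / (1 + t ^ 2) := by
  have h0 : 0 ≤ (3 + √5) / √5 := by positivity
  rw [omegaHatWeight, abs_mul, abs_of_nonneg h0, mul_div_assoc ((3 + √5) / √5)]
  refine mul_le_mul_of_nonneg_left ?_ h0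
  have h1 := Real.abs_sinc_le_one (2 * Real.pi * (Real.goldenRatio + 1) * t)
  have h2 := Real.abs_sinc_le_one (2 * Real.pi / 3 * t)
  have h3 := sq_sinc_le (2 * Real.pi / 3 * t)
  have h4 : 2 / (1 + (2 * Real.pi / 3 * t) ^ 2) ≤ 2 / (1 + t ^ 2) := by
    refine div_le_div_of_nonneg_left (by norm_num) (by positivity) ?_
    have : 1 ≤ (2 * Real.pi / 3) ^ 2 := by nlinarith [Real.pi_gt_three]
    rw [mul_pow]
    nlinarith [sq_nonneg t]
  have h5 : |Real.sinc (2 * Real.pi / 3 * t)| ^ 3 ≤ Real.sinc (2 * Real.pi / 3 * t) ^ 2 := by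
    rw [← sq_abs (Real.sinc _)]
    exact pow_le_pow_of_le_one (abs_nonneg _) h2 (by norm_num)
  rw [abs_mul, abs_pow]
  calc _ ≤ 1 * |Real.sinc (2 * Real.pi / 3 * t)| ^ 3 := by gcongr
    _ ≤ _ := by rw [one_mul]; exact h5.trans (h3.trans h4)

/-! ### Weighted Dirac combs as differences of positive measures -/

/-- The positive measure `∑ i, max (c i) 0 • δ_{p i}`. -/
def comb {ι : Type*} (p : ι → ℝ) (c : ι → ℝ) : Measure ℝ :=
  Measure.sum fun i => ENNReal.ofReal (c i) • Measure.dirac (p i)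

theorem hasSum_integral_comb {ι : Type*} {p : ι → ℝ} {c : ι → ℝ} {f : ℝ → ℂ}
    (hf : Integrable f (comb p c)) :
    HasSum (fun i => ((max (c i) 0 : ℝ) : ℂ) * f (p i)) (∫ x, f x ∂(comb p c)) := by
  refine (hasSum_integral_measure hf).congr_fun fun i => ?_
  rw [integral_smul_measure, integral_dirac, Complex.real_smul, ENNReal.toReal_ofReal']

theorem hasSum_comb_sub {ι : Type*} {p : ι → ℝ} {c : ι → ℝ} {f : ℝ → ℂ}
    (hf : Integrable f (comb p c)) (hf' : Integrable f (comb p (-c))) :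
    HasSum (fun i => (c i : ℂ) * f (p i)) (∫ x, f x ∂(comb p c) - ∫ x, f x ∂(comb p (-c))) := by
  refine ((hasSum_integral_comb hf).sub (hasSum_integral_comb hf')).congr_fun fun i => ?_
  rw [← sub_mul, ← Complex.ofReal_sub]
  congr 2
  simp only [Pi.neg_apply]
  rcases le_total 0 (c i) with h | h
  · rw [max_eq_left h, max_eq_right (by linarith)]; ring
  · rw [max_eq_right h, max_eq_left (by linarith)]; ring

theorem comb_apply {ι : Type*} (p : ι → ℝ) (c : ι → ℝ) {s : Set ℝ} (hs : MeasurableSet s) :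
    comb p c s = ∑' i, ENNReal.ofReal (c i) * s.indicator 1 (p i) := by
  rw [comb, Measure.sum_apply _ hs]
  simp [Measure.dirac_apply' _ hs]

theorem comb_mono {ι : Type*} (p : ι → ℝ) {c d : ι → ℝ} (h : ∀ i, c i ≤ d i) :
    comb p c ≤ comb p d := by
  refine Measure.le_intro fun s hs _ => ?_
  rw [comb_apply _ _ hs, comb_apply _ _ hs]
  exact ENNReal.tsum_le_tsum fun i => by gcongr; exact h i

theorem locallySummable_of_comb {ι : Type*} {p : ι → ℝ} {c : ι → ℝ}
    (h : IsLocallyFiniteMeasure (comb p fun i => |c i|)) :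
    LocallySummable p fun i => (c i : ℂ) := by
  intro K hK
  have h1 : comb p (fun i => |c i|) K < ⊤ := hK.measure_lt_top
  rw [comb_apply _ _ hK.measurableSet] at h1
  have h2 : ∑' i : {i // p i ∈ K}, ENNReal.ofReal |c i| ≠ ⊤ := by
    refine ne_top_of_le_ne_top h1.ne ?_
    refine le_trans (le_of_eq ?_) (ENNReal.tsum_comp_le_tsum_of_injective
      (f := ((↑) : {i // p i ∈ K} → ι)) Subtype.val_injective _)
    refine tsum_congr fun i => ?_
    simp [i.2]
  refine (ENNReal.summable_toReal h2).congr fun i => ?_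
  simp [ENNReal.toReal_ofReal]

theorem diracComb_apply {ι : Type*} {p : ι → ℝ} {c : ι → ℂ} (h : LocallySummable p c)
    (g : C_c(ℝ, ℂ)) : diracComb p c g = ∑' i, c i * g (p i) := by
  rw [diracComb, dif_pos h]; rfl

theorem diracComb_eq_diffMeasure {ι : Type*} {p : ι → ℝ} {c : ι → ℝ}
    [IsLocallyFiniteMeasure (comb p c)] [IsLocallyFiniteMeasure (comb p (-c))]
    (h : LocallySummable p fun i => (c i : ℂ)) :
    diracComb p (fun i => (c i : ℂ)) = diffMeasure (comb p c) (comb p (-c)) := by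
  refine RadonMeasure.ext' fun g => ?_
  rw [diracComb_apply h, diffMeasure_apply]
  exact (hasSum_comb_sub (integrable_cc' g _) (integrable_cc' g _)).tsum_eq

theorem diracComb_comp_equiv {ι κ : Type*} (e : ι ≃ κ) {p : κ → ℝ} {c : κ → ℂ}
    (h : LocallySummable (p ∘ e) (c ∘ e)) :
    LocallySummable p c ∧ diracComb p c = diracComb (p ∘ e) (c ∘ e) := by
  have h' : LocallySummable p c := fun K hK => by
    have := h K hK
    let e' : {i // (p ∘ e) i ∈ K} ≃ {k // p k ∈ K} := e.subtypeEquiv fun i => Iff.rfl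
    exact e'.summable_iff.1 this
  refine ⟨h', RadonMeasure.ext' fun g => ?_⟩
  rw [diracComb_apply h', diracComb_apply h]
  exact (e.tsum_eq fun k => c k * g (p k)).symm

/-! ### The lattice and its dual -/

local notation "τ" => Real.goldenRatio
local notation "τ⋆" => Real.goldenConj

theorem tau_eq : τ = (1 + √5) / 2 := rfl
theorem tau'_eq : τ⋆ = (1 - √5) / 2 := rfl
theorem sqrt5_sq : √5 * √5 = (5 : ℝ) := Real.mul_self_sqrt (by norm_num)
theorem sqrt5_pos : 0 < (√5 : ℝ) := by positivity

/-- The lattice point with coordinates `(m, n)`. -/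
def lp (i : ℤ × ℤ) : ℝ × ℝ := (i.1 + i.2 * τ, i.1 + i.2 * τ⋆)

/-- The point of the dual lattice with coordinates `(k, l)`. -/
def dp (i : ℤ × ℤ) : ℝ × ℝ := (-(i.2 - i.1 * τ⋆) / √5, (i.2 - i.1 * τ) / √5)

theorem lp_sub (i j : ℤ × ℤ) : lp i - lp j = lp (i - j) := by
  ext <;> simp [lp] <;> ring

theorem dp_sub (i j : ℤ × ℤ) : dp i - dp j = dp (i - j) := by
  ext <;> simp [dp] <;> ring

/-- This is the norm form of ℤ[τ]: it factors as (m + nτ)(m + nτ'), and τ, τ' are irrational. -/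
theorem norm_ne_zero {m n : ℤ} (h : (m, n) ≠ (0, 0)) : m ^ 2 + m * n - n ^ 2 ≠ 0 := by
  intro h0
  have h1 : ((m : ℝ) + n * τ) * (m + n * τ⋆) = 0 := by
    have : ((m : ℝ) ^ 2 + m * n - n ^ 2) = 0 := by exact_mod_cast h0
    rw [← this]
    linear_combination (m * n : ℝ) * Real.goldenRatio_add_goldenConj
      + (n : ℝ) ^ 2 * Real.goldenRatio_mul_goldenConj
  have key : ∀ x : ℝ, Irrational x → (m : ℝ) + n * x = 0 → False := fun x hx hmn => by
    rcases eq_or_ne n 0 with rfl | hn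
    · apply h; simpa using hmn
    · have := (hx.intCast_mul hn).intCast_add m
      exact this.ne_zero hmn
  rcases mul_eq_zero.1 h1 with h | h
  · exact key _ Real.goldenRatio_irrational h
  · exact key _ Real.goldenConj_irrational h

theorem lp_mul (i : ℤ × ℤ) : (lp i).1 * (lp i).2 = ((i.1 ^ 2 + i.1 * i.2 - i.2 ^ 2 : ℤ) : ℝ) := by
  simp only [lp]; push_cast
  linear_combination (i.1 * i.2 : ℝ) * Real.goldenRatio_add_goldenConj
      + (i.2 : ℝ) ^ 2 * Real.goldenRatio_mul_goldenConj

theorem dp_mul (i : ℤ × ℤ) :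
    (dp i).1 * (dp i).2 = ((i.1 ^ 2 + i.1 * i.2 - i.2 ^ 2 : ℤ) : ℝ) / 5 := by
  simp only [dp]; push_cast
  rw [div_mul_div_comm, sqrt5_sq]
  congr 1
  linear_combination (i.1 * i.2 : ℝ) * Real.goldenRatio_add_goldenConj
      - (i.1 : ℝ) ^ 2 * Real.goldenRatio_mul_goldenConj

/-- The product of the two coordinates is a nonzero integer. All separation properties of ω come
from this bound. -/
theorem one_le_abs_lp_mul {i : ℤ × ℤ} (h : i ≠ 0) : 1 ≤ |(lp i).1| * |(lp i).2| := by
  rw [← abs_mul, lp_mul, ← Int.cast_abs]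
  exact_mod_cast Int.one_le_abs (norm_ne_zero (m := i.1) (n := i.2) h)

theorem one_fifth_le_abs_dp_mul {i : ℤ × ℤ} (h : i ≠ 0) : 1 / 5 ≤ |(dp i).1| * |(dp i).2| := by
  rw [← abs_mul, dp_mul, abs_div, ← Int.cast_abs, abs_of_pos (by norm_num : (0 : ℝ) < 5)]
  gcongr
  exact_mod_cast Int.one_le_abs (norm_ne_zero (m := i.1) (n := i.2) h)

theorem lp_fst_injective : Function.Injective fun i => (lp i).1 := fun i j hij => by
  by_contra hne
  have := one_le_abs_lp_mul (sub_ne_zero.2 hne)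
  have h0 : (lp (i - j)).1 = 0 := by rw [← lp_sub]; simpa [sub_eq_zero] using hij
  rw [h0] at this
  norm_num at this

theorem lp_injective : Function.Injective lp := fun _ _ hij =>
  lp_fst_injective (congrArg Prod.fst hij)

theorem dp_injective : Function.Injective dp := fun i j hij => by
  by_contra hne
  have := one_fifth_le_abs_dp_mul (sub_ne_zero.2 hne)
  rw [← dp_sub, hij] at this
  norm_num at this

theorem range_lp : Set.range lp = lattice := by
  ext p; constructor
  · rintro ⟨i, rfl⟩; exact ⟨i.1, i.2, rfl⟩
  · rintro ⟨m, n, rfl⟩; exact ⟨(m, n), rfl⟩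

theorem ch_eq_one_iff {x : ℝ} : ch x = 1 ↔ ∃ n : ℤ, x = n := by
  rw [ch, Complex.exp_eq_one_iff]
  have hp : 2 * (Real.pi : ℂ) * Complex.I ≠ 0 := Complex.two_pi_I_ne_zero
  refine exists_congr fun n => ?_
  rw [mul_comm (n : ℂ), mul_right_inj' hp]
  exact_mod_cast Iff.rfl

/-- The points `dp` pair integrally with the lattice, through -(mk + nl). Conversely, pairing with
the basis (1, 1), (τ, τ') determines a dual point by two integers. -/
theorem range_dp : Set.range dp = dualLattice := by
  have h5 : √5 ≠ 0 := sqrt5_pos.ne'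
  have hpair : ∀ m n k l : ℤ, (m + n * τ) * (dp (k, l)).1 + (m + n * τ⋆) * (dp (k, l)).2
      = ((-(m * k + n * l) : ℤ) : ℝ) := fun m n k l => by
    simp only [dp, tau_eq, tau'_eq]; push_cast
    field_simp
    ring_nf
  ext y; constructor
  · rintro ⟨⟨k, l⟩, rfl⟩ x ⟨m, n, rfl⟩
    exact ch_eq_one_iff.2 ⟨_, hpair m n k l⟩
  · intro hy
    obtain ⟨k, hk⟩ := ch_eq_one_iff.1 (hy (lp (1, 0)) ⟨1, 0, rfl⟩)
    obtain ⟨l, hl⟩ := ch_eq_one_iff.1 (hy (lp (0, 1)) ⟨0, 1, rfl⟩)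
    simp only [lp, tau_eq, tau'_eq, Int.cast_one, Int.cast_zero] at hk hl
    refine ⟨(-k, -l), ?_⟩
    ext
    · simp only [dp, tau_eq, tau'_eq]; push_cast
      rw [← hk, ← hl]
      field_simp
      ring
    · simp only [dp, tau_eq, tau'_eq]; push_cast
      rw [← hk, ← hl]
      field_simp
      ring

/-- The coordinates of the lattice. -/
def latticeEquiv : ℤ × ℤ ≃ lattice :=
  (Equiv.ofInjective lp lp_injective).trans (Equiv.setCongr range_lp)

/-- The coordinates of the dual lattice. -/
def dualEquiv : ℤ × ℤ ≃ dualLattice :=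
  (Equiv.ofInjective dp dp_injective).trans (Equiv.setCongr range_dp)

theorem latticeEquiv_apply (i : ℤ × ℤ) : (latticeEquiv i).1 = lp i := rfl

theorem lp_fst_sub_snd (i : ℤ × ℤ) : (lp i).1 - (lp i).2 = i.2 * √5 := by
  simp only [lp, tau_eq, tau'_eq]; ring

/-- There are finitely many lattice points in every rectangle. -/
theorem finite_lp (R S : ℝ) : {i : ℤ × ℤ | |(lp i).1| ≤ R ∧ |(lp i).2| ≤ S}.Finite := by
  have h5 := sqrt5_pos
  obtain ⟨N, hN⟩ := exists_nat_ge ((R + S) / √5)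
  obtain ⟨M, hM⟩ := exists_nat_ge (R + N * τ)
  refine (((Set.finite_Icc (-(M : ℤ)) M).prod (Set.finite_Icc (-(N : ℤ)) N))).subset ?_
  rintro ⟨m, n⟩ ⟨h1, h2⟩
  have hn : |(n : ℝ)| ≤ N := by
    refine le_trans ?_ hN
    have e : |(n : ℝ)| * √5 = |(lp (m, n)).1 - (lp (m, n)).2| := by
      rw [lp_fst_sub_snd, abs_mul, abs_of_pos h5]
    rw [le_div_iff₀ h5, e]
    exact (abs_sub _ _).trans (add_le_add h1 h2)
  have hm : |(m : ℝ)| ≤ M := by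
    refine le_trans ?_ hM
    have : (m : ℝ) = (lp (m, n)).1 - n * τ := by simp [lp]
    rw [this]
    refine (abs_sub _ _).trans (add_le_add h1 ?_)
    rw [abs_mul, abs_of_pos Real.goldenRatio_pos]
    exact mul_le_mul_of_nonneg_right hn Real.goldenRatio_pos.le
  rw [abs_le] at hn hm
  exact ⟨⟨by exact_mod_cast hm.1, by exact_mod_cast hm.2⟩,
    ⟨by exact_mod_cast hn.1, by exact_mod_cast hn.2⟩⟩

/-! ### The transform of the ping-pong measure is translation bounded -/

theorem summable_inv_one_add_sq : Summable fun j : ℤ => 1 / (1 + (j : ℝ) ^ 2) := by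
  have h := Real.summable_one_div_int_pow.2 (show 1 < 2 by norm_num)
  refine h.of_norm_bounded_eventually ?_
  rw [Filter.eventually_cofinite]
  refine (Set.finite_singleton (0 : ℤ)).subset fun j hj => ?_
  by_contra h0
  have h0' : (j : ℝ) ≠ 0 := by exact_mod_cast h0
  refine hj ?_
  rw [Real.norm_of_nonneg (by positivity)]
  exact one_div_le_one_div_of_le (by positivity) (by linarith)

theorem one_div_one_add_sq_le (t : ℝ) :
    1 / (1 + t ^ 2) ≤ 3 * (1 / (1 + (⌊5 * t⌋ : ℝ) ^ 2)) * 25 := by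
  have h1 := Int.floor_le (5 * t)
  have h2 := Int.lt_floor_add_one (5 * t)
  set j : ℝ := (⌊5 * t⌋ : ℝ)
  rw [show 3 * (1 / (1 + j ^ 2)) * 25 = 75 / (1 + j ^ 2) by ring,
    div_le_div_iff₀ (by positivity) (by positivity)]
  have h3 : (j - 5 * t) ^ 2 ≤ 1 := by nlinarith
  nlinarith [sq_nonneg (j - 10 * t), sq_nonneg t]

/-- Distinct dual points satisfy |Δy| |Δy⋆| ≥ 1/5, so those with y in an interval of length 1 have
y⋆ at least 1/5 apart. Then ⌊5 y⋆⌋ is injective on them, and the weights are dominated by a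
convergent series over ℤ that does not depend on the interval. -/
theorem translationBounded_dual :
    TranslationBounded (comb (fun i => (dp i).1) fun i => |omegaHatWeight (dp i).2|) := by
  set A : ℝ := (3 + √5) / √5 * 2
  have hA : 0 ≤ A := by positivity
  set B : ℤ → ENNReal := fun j => ENNReal.ofReal (A * 75 * (1 / (1 + (j : ℝ) ^ 2)))
  have hB : ∑' j, B j ≠ ⊤ :=
    (Summable.tsum_ofReal_lt_top (summable_inv_one_add_sq.mul_left (A * 75))).ne
  refine ⟨∑' j, B j, hB, fun x => ?_⟩
  rw [comb_apply _ _ measurableSet_Icc]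
  set s : Set (ℤ × ℤ) := {i | (dp i).1 ∈ Set.Icc x (x + 1)}
  have hinj : Function.Injective fun i : s => ⌊5 * (dp i).2⌋ := by
    rintro ⟨i, hi⟩ ⟨j, hj⟩ hij
    by_contra hne
    have hne' : i - j ≠ 0 := fun h => hne (Subtype.ext (sub_eq_zero.1 h))
    have h1 := one_fifth_le_abs_dp_mul hne'
    rw [← dp_sub] at h1
    have h2 : |(dp i - dp j).1| ≤ 1 := by
      rw [Prod.fst_sub, abs_le]; constructor <;> linarith [hi.1, hi.2, hj.1, hj.2]
    have h3 : |(dp i - dp j).2| < 1 / 5 := by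
      have := Int.abs_sub_lt_one_of_floor_eq_floor hij
      simp only at this
      rw [← mul_sub, abs_mul, abs_of_pos (by norm_num : (0 : ℝ) < 5)] at this
      rw [Prod.snd_sub]; linarith
    nlinarith [abs_nonneg (dp i - dp j).1, abs_nonneg (dp i - dp j).2]
  calc ∑' i, ENNReal.ofReal |omegaHatWeight (dp i).2| * (Set.Icc x (x + 1)).indicator 1 (dp i).1
      = ∑' i : s, ENNReal.ofReal |omegaHatWeight (dp i).2| := by
        rw [tsum_subtype s fun i => ENNReal.ofReal |omegaHatWeight (dp i).2|]
        refine tsum_congr fun i => ?_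
        by_cases hi : (dp i).1 ∈ Set.Icc x (x + 1)
        · rw [Set.indicator_of_mem hi, Set.indicator_of_mem (s := s) hi]; simp
        · rw [Set.indicator_of_notMem hi, Set.indicator_of_notMem (s := s) hi, mul_zero]
    _ ≤ ∑' i : s, B ⌊5 * (dp i).2⌋ := by
        refine ENNReal.tsum_le_tsum fun i => ENNReal.ofReal_le_ofReal ?_
        refine (abs_omegaHatWeight_le _).trans ?_
        rw [div_eq_mul_one_div, mul_assoc A]
        refine mul_le_mul_of_nonneg_left ((one_div_one_add_sq_le _).trans (le_of_eq ?_)) hA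
        ring
    _ ≤ ∑' j, B j := ENNReal.tsum_comp_le_tsum_of_injective hinj B

/-! ### Poisson summation for the lattice -/

theorem tsum_int_eq_tsum_fourier {f : ℝ → ℂ} (hf : Continuous f) (hc : HasCompactSupport f)
    (hs : Summable fun n : ℤ => 𝓕 f n) : ∑' n : ℤ, f n = ∑' n : ℤ, 𝓕 f n := by
  have hO : f =O[cocompact ℝ] fun x : ℝ => |x| ^ (-(2 : ℝ)) := by
    have h0 : f =ᶠ[cocompact ℝ] 0 := by
      rw [← coclosedCompact_eq_cocompact]
      exact hasCompactSupport_iff_eventuallyEq.1 hc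
    exact h0.trans_isBigO (Asymptotics.isBigO_zero _ _)
  simpa using Real.tsum_eq_tsum_fourier_of_rpow_decay_of_summable hf one_lt_two hO hs 0

theorem exists_bound_support (φ : C_c(ℝ, ℂ)) : ∃ R : ℝ, 0 ≤ R ∧ ∀ x, φ x ≠ 0 → |x| ≤ R := by
  obtain ⟨R, hR⟩ := φ.hasCompactSupport.isCompact.isBounded.exists_norm_le
  exact ⟨|R|, abs_nonneg R, fun x hx => (hR x (subset_tsupport _ hx)).trans (le_abs_self R)⟩

theorem exists_norm_le (φ : C_c(ℝ, ℂ)) : ∃ C : ℝ, ∀ x, ‖φ x‖ ≤ C :=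
  φ.hasCompactSupport.exists_bound_of_continuous φ.continuous

/-- The partial Fourier transform of `(a, b) ↦ g (a + b τ) H (a + b τ⋆)` in the first variable. -/
def partialFourier (g H : C_c(ℝ, ℂ)) (k : ℤ) (b : ℝ) : ℂ :=
  ∫ x, ch (-(k * (x - b * τ))) * (g x * H (x - √5 * b))

/-- The substitution x = a + bτ, with τ - τ' = √5. The form in x keeps g independent of b, which
makes dominated convergence and Fubini immediate. -/
theorem partialFourier_eq (g H : C_c(ℝ, ℂ)) (k : ℤ) (b : ℝ) :
    partialFourier g H k b = ∫ a, ch (-(a * k)) * (g (a + b * τ) * H (a + b * τ⋆)) := by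
  rw [partialFourier, ← integral_add_right_eq_self _ (b * τ)]
  congr 1; ext a
  have e : a + b * τ - √5 * b = a + b * τ⋆ := by rw [tau_eq, tau'_eq]; ring
  rw [e, add_sub_cancel_right, mul_comm a]

theorem continuous_partialFourier (g H : C_c(ℝ, ℂ)) (k : ℤ) :
    Continuous (partialFourier g H k) := by
  obtain ⟨C, hC⟩ := exists_norm_le H
  have hg := g.continuous
  have hH := H.continuous
  refine continuous_of_dominated (bound := fun x => ‖g x‖ * C) (fun b => ?_) (fun b => ?_)
    ((integrable_cc g).norm.mul_const C) ?_
  · exact Continuous.aestronglyMeasurable (by fun_prop)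
  · refine Eventually.of_forall fun x => ?_
    rw [norm_mul, norm_ch, one_mul, norm_mul]
    exact mul_le_mul_of_nonneg_left (hC _) (norm_nonneg _)
  · exact Eventually.of_forall fun x => by fun_prop

theorem hasCompactSupport_of_abs_le {f : ℝ → ℂ} {R : ℝ} (h : ∀ x, f x ≠ 0 → |x| ≤ R) :
    HasCompactSupport f :=
  HasCompactSupport.intro (isCompact_Icc (a := -R) (b := R)) fun x hx => by
    by_contra h0
    exact hx (abs_le.1 (h x h0))

theorem hasCompactSupport_partialFourier (g H : C_c(ℝ, ℂ)) (k : ℤ) :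
    HasCompactSupport (partialFourier g H k) := by
  obtain ⟨R, hR0, hR⟩ := exists_bound_support g
  obtain ⟨S, hS0, hS⟩ := exists_bound_support H
  refine hasCompactSupport_of_abs_le (R := (R + S) / √5) fun b hb => ?_
  by_contra hlt
  refine hb (integral_eq_zero_of_ae (Eventually.of_forall fun x => ?_))
  by_contra h0
  have h1 := hR x fun h => h0 (by simp [h])
  have h2 := hS (x - √5 * b) fun h => h0 (by simp [h])
  refine hlt ?_
  rw [le_div_iff₀ sqrt5_pos]
  calc |b| * √5 = |√5 * b| := by rw [abs_mul, abs_of_pos sqrt5_pos, mul_comm]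
    _ = |x - (x - √5 * b)| := by ring_nf
    _ ≤ R + S := (abs_sub _ _).trans (add_le_add h1 h2)

theorem integral_comp_sub_mul (F : ℝ → ℂ) (x : ℝ) :
    ∫ b, F (x - √5 * b) = ((1 / √5 : ℝ) : ℂ) * ∫ t, F t := by
  have h := Measure.integral_comp_mul_left (fun s => F (x - s)) √5
  rw [h, integral_sub_left_eq_self, abs_of_pos (inv_pos.2 sqrt5_pos), Complex.real_smul, one_div]

/-- After Fubini, the substitution t = x - √5 b separates the double integral into a product. Its
Jacobian is the inverse covolume 1/√5, and the exponents are the coordinates of the dual point. -/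
theorem fourier_partialFourier (g H : C_c(ℝ, ℂ)) (k l : ℤ) :
    𝓕 (partialFourier g H k) l =
      ((1 / √5 : ℝ) : ℂ) * (invFourier g (dp (k, l)).1 * invFourier H (dp (k, l)).2) := by
  obtain ⟨R, hR0, hR⟩ := exists_bound_support g
  obtain ⟨S, hS0, hS⟩ := exists_bound_support H
  have hg := g.continuous
  have hH := H.continuous
  have h5 := sqrt5_pos
  have hint : Integrable (Function.uncurry fun b x : ℝ =>
      ch (-(b * l)) * (ch (-(k * (x - b * τ))) * (g x * H (x - √5 * b)))) (volume.prod volume) := by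
    refine Continuous.integrable_of_hasCompactSupport (by fun_prop) ?_
    refine HasCompactSupport.intro ((isCompact_Icc (a := -((R + S) / √5)) (b := (R + S) / √5)).prod
      (isCompact_Icc (a := -R) (b := R))) ?_
    rintro ⟨b, x⟩ hbx
    by_contra h0
    have h1 := hR x fun h => h0 (by simp [h])
    have h2 := hS (x - √5 * b) fun h => h0 (by simp [h])
    refine hbx ⟨abs_le.1 ?_, abs_le.1 h1⟩
    rw [le_div_iff₀ h5]
    calc |b| * √5 = |√5 * b| := by rw [abs_mul, abs_of_pos h5, mul_comm]
      _ = |x - (x - √5 * b)| := by ring_nf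
      _ ≤ R + S := (abs_sub _ _).trans (add_le_add h1 h2)
  calc 𝓕 (partialFourier g H k) l = ∫ b, ∫ x,
        ch (-(b * l)) * (ch (-(k * (x - b * τ))) * (g x * H (x - √5 * b))) := by
        rw [fourier_eq_ch]
        congr 1; ext b
        rw [partialFourier, ← integral_const_mul]
    _ = ∫ x, ∫ b, ch (-(b * l)) * (ch (-(k * (x - b * τ))) * (g x * H (x - √5 * b))) :=
        integral_integral_swap hint
    _ = ∫ x, ((1 / √5 : ℝ) : ℂ) * invFourier H (dp (k, l)).2 * (ch (x * (dp (k, l)).1) * g x) := by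
        congr 1; ext x
        have e : ∀ b, ch (-(b * l)) * (ch (-(k * (x - b * τ))) * (g x * H (x - √5 * b))) =
            (fun t => ch (x * (dp (k, l)).1) * g x * (ch (t * (dp (k, l)).2) * H t))
              (x - √5 * b) := fun b => by
          have e1 : ch (-(b * l)) * ch (-(k * (x - b * τ))) =
              ch (x * (dp (k, l)).1) * ch ((x - √5 * b) * (dp (k, l)).2) := by
            rw [← ch_add, ← ch_add]
            congr 1
            simp only [dp, tau_eq, tau'_eq]
            field_simp
            ring_nf
          dsimp only
          linear_combination g x * H (x - √5 * b) * e1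
        rw [integral_congr_ae (Eventually.of_forall e)]
        refine (integral_comp_sub_mul (fun t =>
          ch (x * (dp (k, l)).1) * g x * (ch (t * (dp (k, l)).2) * H t)) x).trans ?_
        rw [integral_const_mul, ← invFourier_eq]
        ring
    _ = _ := by
        rw [integral_const_mul, ← invFourier_eq]
        ring

theorem finite_support_lp (g H : C_c(ℝ, ℂ)) :
    (Function.support fun i : ℤ × ℤ => g (lp i).1 * H (lp i).2).Finite := by
  obtain ⟨R, hR0, hR⟩ := exists_bound_support g
  obtain ⟨S, hS0, hS⟩ := exists_bound_support H
  refine (finite_lp R S).subset fun i hi => ?_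
  exact ⟨hR _ (left_ne_zero_of_mul hi), hS _ (right_ne_zero_of_mul hi)⟩

/-- Poisson summation for the lattice. -/
theorem tsum_lp_eq_tsum_dp (g H : C_c(ℝ, ℂ))
    (hs : Summable fun i => invFourier g (dp i).1 * invFourier H (dp i).2) :
    ∑' i, g (lp i).1 * H (lp i).2 =
      ((1 / √5 : ℝ) : ℂ) * ∑' i, invFourier g (dp i).1 * invFourier H (dp i).2 := by
  obtain ⟨R, hR0, hR⟩ := exists_bound_support g
  obtain ⟨S, hS0, hS⟩ := exists_bound_support H
  have hg := g.continuous
  have hH := H.continuous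
  have h5 := sqrt5_pos
  have hs' := hs.mul_left ((1 / √5 : ℝ) : ℂ)
  have e1 : ∀ k : ℤ, ∑' n : ℤ, partialFourier g H k n = ∑' l : ℤ,
      ((1 / √5 : ℝ) : ℂ) * (invFourier g (dp (k, l)).1 * invFourier H (dp (k, l)).2) := fun k => by
    rw [tsum_int_eq_tsum_fourier (continuous_partialFourier g H k)
      (hasCompactSupport_partialFourier g H k)]
    · simp_rw [fourier_partialFourier]
    · simp_rw [fourier_partialFourier]
      exact hs'.prod_factor k
  obtain ⟨N, hN⟩ := exists_nat_ge ((R + S) / √5)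
  have hn : ∀ (n : ℤ) (a : ℝ), g (a + n * τ) * H (a + n * τ⋆) ≠ 0 →
      n ∈ Finset.Icc (-(N : ℤ)) N := fun n a h => by
    have h1 := hR _ (left_ne_zero_of_mul h)
    have h2 := hS _ (right_ne_zero_of_mul h)
    have h3 : |(n : ℝ)| ≤ N := by
      refine le_trans ?_ hN
      rw [le_div_iff₀ h5]
      calc |(n : ℝ)| * √5 = |n * √5| := by rw [abs_mul, abs_of_pos h5]
        _ = |(a + n * τ) - (a + n * τ⋆)| := by congr 1; rw [tau_eq, tau'_eq]; ring
        _ ≤ R + S := (abs_sub _ _).trans (add_le_add h1 h2)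
    have := abs_le.1 h3
    exact Finset.mem_Icc.2 ⟨by exact_mod_cast this.1, by exact_mod_cast this.2⟩
  -- The planar formula is two one-dimensional ones. Poisson in m is applied to G, and its transform
  -- at k is a sum over n to which Poisson applies again. Compact supports bound n independently of
  -- a, so the inner sum is finite.
  set G : ℝ → ℂ := fun a => ∑ n ∈ Finset.Icc (-(N : ℤ)) N, g (a + n * τ) * H (a + n * τ⋆) with hG
  have hcs : ∀ n : ℤ, HasCompactSupport fun a : ℝ => g (a + n * τ) * H (a + n * τ⋆) := fun n =>
    hasCompactSupport_of_abs_le (R := R + |n * τ|) fun a h => by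
      have h1 := hR _ (left_ne_zero_of_mul h)
      calc |a| = |(a + n * τ) - n * τ| := by ring_nf
        _ ≤ _ := (abs_sub _ _).trans (add_le_add_left h1 _)
  have hGc : Continuous G := by fun_prop
  have hGs : HasCompactSupport G := by
    refine hasCompactSupport_of_abs_le (R := R + N * τ) fun a h => ?_
    obtain ⟨n, hnm, h⟩ := Finset.exists_ne_zero_of_sum_ne_zero h
    have h1 := hR _ (left_ne_zero_of_mul h)
    have h2 : |(n : ℝ)| ≤ N := by
      rw [Finset.mem_Icc] at hnm
      exact abs_le.2 ⟨by exact_mod_cast hnm.1, by exact_mod_cast hnm.2⟩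
    calc |a| = |(a + n * τ) - n * τ| := by ring_nf
      _ ≤ R + |n * τ| := (abs_sub _ _).trans (add_le_add_left h1 _)
      _ ≤ _ := by
        rw [abs_mul, abs_of_pos Real.goldenRatio_pos]
        gcongr
  have e2 : ∀ k : ℤ, 𝓕 G k = ∑' n : ℤ, partialFourier g H k n := fun k => by
    rw [fourier_eq_ch, tsum_eq_sum (s := Finset.Icc (-(N : ℤ)) N)]
    · simp_rw [hG, Finset.mul_sum]
      rw [integral_finsetSum]
      · simp_rw [partialFourier_eq]
      · intro n _
        exact integrable_ch_mul (Continuous.integrable_of_hasCompactSupport (by fun_prop) (hcs n))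
          (by fun_prop)
    · intro n hnm
      rw [partialFourier_eq]
      refine integral_eq_zero_of_ae (Eventually.of_forall fun a => ?_)
      by_contra h0
      exact hnm (hn n a (right_ne_zero_of_mul h0))
  have e3 : ∀ k : ℤ, 𝓕 G k = ∑' l : ℤ,
      ((1 / √5 : ℝ) : ℂ) * (invFourier g (dp (k, l)).1 * invFourier H (dp (k, l)).2) := fun k => by
    rw [e2, e1]
  rw [← tsum_mul_left, hs'.tsum_prod,
    (summable_of_hasFiniteSupport (finite_support_lp g H)).tsum_prod]
  simp_rw [← e3]
  rw [← tsum_int_eq_tsum_fourier hGc hGs (by simp_rw [e3]; exact hs'.prod)]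
  refine tsum_congr fun m => ?_
  rw [hG, tsum_eq_sum (s := Finset.Icc (-(N : ℤ)) N)]
  · rfl
  · intro n hnm
    by_contra h0
    exact hnm (hn n m h0)

/-! ### The transform of the ping-pong measure -/

/-- The positive part of the transform of the ping-pong measure. -/
def omegaPos : Measure ℝ := comb (fun i => (dp i).1) fun i => omegaHatWeight (dp i).2

/-- The negative part of the transform of the ping-pong measure. -/
def omegaNeg : Measure ℝ := comb (fun i => (dp i).1) (-fun i => omegaHatWeight (dp i).2)

theorem translationBounded_omegaPos : TranslationBounded omegaPos :=
  translationBounded_dual.mono (comb_mono _ fun _ => le_abs_self _)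

theorem translationBounded_omegaNeg : TranslationBounded omegaNeg :=
  translationBounded_dual.mono (comb_mono _ fun _ => neg_le_abs _)

instance : IsLocallyFiniteMeasure omegaPos := translationBounded_omegaPos.isLocallyFinite
instance : IsLocallyFiniteMeasure omegaNeg := translationBounded_omegaNeg.isLocallyFinite

theorem TranslationBounded.integrable_normSqInvFourier {m : Measure ℝ} (h : TranslationBounded m)
    (φ : C_c(ℝ, ℂ)) : Integrable (normSqInvFourier φ) m :=
  ((h.memLp φ).integrable_norm_pow (p := 2) two_ne_zero).ofReal

theorem locallySummable_dual : LocallySummable (fun y : dualLattice => y.1.1)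
      (fun y => (omegaHatWeight y.1.2 : ℂ)) ∧
    diracComb (fun y : dualLattice => y.1.1) (fun y => (omegaHatWeight y.1.2 : ℂ)) =
      diffMeasure omegaPos omegaNeg := by
  have h := locallySummable_of_comb translationBounded_dual.isLocallyFinite
  have h2 := diracComb_comp_equiv dualEquiv (p := fun y : dualLattice => y.1.1)
    (c := fun y => (omegaHatWeight y.1.2 : ℂ)) h
  refine ⟨h2.1, h2.2.trans ?_⟩
  exact @diracComb_eq_diffMeasure _ _ _ (inferInstanceAs (IsLocallyFiniteMeasure omegaPos))
    (inferInstanceAs (IsLocallyFiniteMeasure omegaNeg)) h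

theorem locallySummable_omega : LocallySummable (fun p : lattice => p.1.1)
    (fun p => (h p.1.2 : ℂ)) := by
  refine (diracComb_comp_equiv latticeEquiv (p := fun p : lattice => p.1.1)
    (c := fun p => (h p.1.2 : ℂ)) fun K hK => ?_).1
  obtain ⟨R, hR⟩ := hK.isBounded.exists_norm_le
  refine summable_of_hasFiniteSupport ?_
  refine Set.Finite.of_finite_image ((finite_lp R (τ + 2)).subset ?_)
    (Subtype.val_injective.injOn)
  rintro _ ⟨⟨i, hi⟩, h0, rfl⟩
  refine ⟨hR _ hi, ?_⟩
  by_contra hlt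
  exact h0 (by simp [latticeEquiv_apply, h_eq_zero (not_le.1 hlt)])

theorem omega_apply (g : C_c(ℝ, ℂ)) : omega g = ∑' i, g (lp i).1 * hc (lp i).2 := by
  rw [omega, diracComb_apply locallySummable_omega, ← latticeEquiv.tsum_eq]
  exact tsum_congr fun i => mul_comm _ _

/-- Poisson summation for (φ * φ~) ⊗ h. Summability on the dual side comes from translation
boundedness of the two parts. -/
theorem omega_selfConv (φ : C_c(ℝ, ℂ)) : omega (selfConv φ) =
    ∫ y, normSqInvFourier φ y ∂omegaPos - ∫ y, normSqInvFourier φ y ∂omegaNeg := by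
  have hS : ∀ y, invFourier (selfConv φ) y = normSqInvFourier φ y := fun y => by
    rw [invFourier_eq_fourier, fourier_selfConv, neg_neg]; rfl
  have hsum := hasSum_comb_sub (p := fun i => (dp i).1) (c := fun i => omegaHatWeight (dp i).2)
    (translationBounded_omegaPos.integrable_normSqInvFourier φ)
    (translationBounded_omegaNeg.integrable_normSqInvFourier φ)
  have e : ∀ i, invFourier (selfConv φ) (dp i).1 * invFourier hc (dp i).2 =
      (√5 : ℂ) * ((omegaHatWeight (dp i).2 : ℂ) * normSqInvFourier φ (dp i).1) := fun i => by
    rw [hS, invFourier_hc]; push_cast; ring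
  have hs : Summable fun i => invFourier (selfConv φ) (dp i).1 * invFourier hc (dp i).2 := by
    simp_rw [e]; exact hsum.summable.mul_left _
  rw [omega_apply, tsum_lp_eq_tsum_dp _ _ hs]
  simp_rw [e]
  rw [tsum_mul_left, hsum.tsum_eq, ← mul_assoc]
  have : (√5 : ℂ) ≠ 0 := by exact_mod_cast sqrt5_pos.ne'
  push_cast
  rw [one_div_mul_cancel this, one_mul]
  rfl

theorem isFourierTransform_omega : IsFourierTransform omega (diffMeasure omegaPos omegaNeg) :=
  isFourierTransform_diffMeasure translationBounded_omegaPos translationBounded_omegaNeg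
    omega_selfConv

/-! ### Subsets of the Fibonacci model set and their autocorrelations -/

/-- Two points of the window [-1, τ - 1) differ by less than τ. -/
theorem Fib_sub {Λ : Set ℝ} (hΛ : Λ ⊆ Fib) {z : ℝ} (hz : z ∈ Λ - Λ) :
    ∃ i, (lp i).1 = z ∧ |(lp i).2| ≤ τ := by
  obtain ⟨x, hx, y, hy, rfl⟩ := hz
  obtain ⟨s, hs, hs1, hs2⟩ := hΛ hx
  obtain ⟨t, ht, ht1, ht2⟩ := hΛ hy
  rw [← range_lp] at hs ht
  obtain ⟨i, hi⟩ := hs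
  obtain ⟨j, hj⟩ := ht
  refine ⟨i - j, ?_, ?_⟩
  · rw [← lp_sub, hi, hj]; rfl
  · rw [← lp_sub, hi, hj, abs_le]; constructor <;> dsimp only [Prod.snd_sub] <;> linarith

theorem finite_sub {Λ : Set ℝ} (hΛ : Λ ⊆ Fib) {K : Set ℝ} (hK : IsCompact K) :
    ((Λ - Λ) ∩ K).Finite := by
  obtain ⟨R, hR⟩ := hK.isBounded.exists_norm_le
  refine ((finite_lp R τ).image fun i => (lp i).1).subset ?_
  rintro z ⟨hz, hzK⟩
  obtain ⟨i, rfl, hi⟩ := Fib_sub hΛ hz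
  exact ⟨i, ⟨hR _ hzK, hi⟩, rfl⟩

theorem finite_inter {Λ : Set ℝ} (hΛ : Λ ⊆ Fib) {K : Set ℝ} (hK : IsCompact K) :
    (Λ ∩ K).Finite := by
  obtain ⟨R, hR⟩ := hK.isBounded.exists_norm_le
  refine ((finite_lp R τ).image fun i => (lp i).1).subset ?_
  rintro x ⟨hx, hxK⟩
  obtain ⟨s, hs, hs1, hs2⟩ := hΛ hx
  rw [← range_lp] at hs
  obtain ⟨i, hi⟩ := hs
  have := Real.one_lt_goldenRatio
  refine ⟨i, ⟨?_, ?_⟩, by simp [hi]⟩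
  · rw [hi]; exact hR _ hxK
  · rw [hi, abs_le]; constructor <;> dsimp only <;> linarith

theorem locallySummable_autocorrelation {Λ : Set ℝ} (hΛ : Λ ⊆ Fib) (η : ℝ → ℝ) :
    LocallySummable (fun z : ↥(Λ - Λ) => (z : ℝ)) (fun z => (η z : ℂ)) := by
  intro K hK
  have : Finite {z : ↥(Λ - Λ) // (z : ℝ) ∈ K} := by
    refine Set.Finite.of_finite_image (s := {z : ↥(Λ - Λ) | (z : ℝ) ∈ K}) ?_
      (Subtype.val_injective.injOn)
    refine (finite_sub hΛ hK).subset ?_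
    rintro _ ⟨z, hz, rfl⟩
    exact ⟨z.2, hz⟩
  exact Summable.of_finite

theorem autocorrelation_apply {Λ : Set ℝ} (hΛ : Λ ⊆ Fib) (η : ℝ → ℝ) (g : C_c(ℝ, ℂ)) :
    autocorrelation Λ η g = ∑' z : ↥(Λ - Λ), (η z : ℂ) * g z :=
  diracComb_apply (locallySummable_autocorrelation hΛ η) g

theorem autocorrelation_apply_eq_sum {Λ : Set ℝ} (hΛ : Λ ⊆ Fib) (η : ℝ → ℝ) (g : C_c(ℝ, ℂ))
    {Z : Finset ℝ} (hZ : (Z : Set ℝ) = (Λ - Λ) ∩ tsupport g) :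
    autocorrelation Λ η g = ∑ z ∈ Z, (η z : ℂ) * g z := by
  rw [autocorrelation_apply hΛ, tsum_subtype (Λ - Λ) fun z => (η z : ℂ) * g z,
    tsum_eq_sum (s := Z)]
  · refine Finset.sum_congr rfl fun z hz => Set.indicator_of_mem ?_ _
    exact (hZ.subset hz).1
  · intro z hz
    by_contra h0
    have h1 := Set.mem_of_indicator_ne_zero h0
    rw [Set.indicator_of_mem h1] at h0
    exact hz (hZ.superset ⟨h1, subset_tsupport _ (right_ne_zero_of_mul h0)⟩)

/-- The finite approximations converge vaguely to the autocorrelation. -/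
theorem HasAutocorrelation.tendsto {A : ℕ → Set ℝ} {Λ : Set ℝ} {η : ℝ → ℝ}
    (h : HasAutocorrelation A Λ η) (hΛ : Λ ⊆ Fib) {F : ℕ → Finset ℝ}
    (hF : ∀ n, (F n : Set ℝ) = Λ ∩ A n) (g : C_c(ℝ, ℂ)) :
    Tendsto (fun n => (((volume.real (A n))⁻¹ : ℝ) : ℂ) * ∑ x ∈ F n, ∑ y ∈ F n, g (x - y)) atTop
      (𝓝 (autocorrelation Λ η g)) := by
  classical
  obtain ⟨Z, hZ⟩ := (finite_sub hΛ g.hasCompactSupport.isCompact).exists_finset_coe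
  rw [autocorrelation_apply_eq_sum hΛ η g hZ]
  -- Grouping the pairs by their difference leaves a fixed finite set of z, those of Λ - Λ in the
  -- support of g, so the coefficientwise limits suffice.
  have key : ∀ n, (((volume.real (A n))⁻¹ : ℝ) : ℂ) * ∑ x ∈ F n, ∑ y ∈ F n, g (x - y) =
      ∑ z ∈ Z, (((volume.real (A n))⁻¹ * (({p : ℝ × ℝ | p.1 ∈ Λ ∩ A n ∧ p.2 ∈ Λ ∩ A n ∧
        p.1 - p.2 = z}.ncard : ℕ) : ℝ) : ℝ) : ℂ) * g z := fun n => by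
    have hsub : ∀ p ∈ F n ×ˢ F n, p.1 - p.2 ∈ Λ - Λ := fun p hp => by
      rw [Finset.mem_product] at hp
      exact Set.sub_mem_sub ((hF n).subset hp.1).1 ((hF n).subset hp.2).1
    have e1 : ∑ p ∈ F n ×ˢ F n, g (p.1 - p.2) =
        ∑ p ∈ (F n ×ˢ F n) with p.1 - p.2 ∈ Z, g (p.1 - p.2) := by
      refine (Finset.sum_filter_of_ne fun p hp h0 => ?_).symm
      exact hZ.superset ⟨hsub p hp, subset_tsupport _ h0⟩
    rw [← Finset.sum_product (f := fun p : ℝ × ℝ => g (p.1 - p.2)), e1,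
      ← Finset.sum_fiberwise_of_maps_to (s := (F n ×ˢ F n).filter fun p => p.1 - p.2 ∈ Z) (t := Z)
        (g := fun p => p.1 - p.2) (fun p hp => (Finset.mem_filter.1 hp).2), Finset.mul_sum]
    refine Finset.sum_congr rfl fun z hz => ?_
    have e2 : {p : ℝ × ℝ | p.1 ∈ Λ ∩ A n ∧ p.2 ∈ Λ ∩ A n ∧ p.1 - p.2 = z} =
        (((F n ×ˢ F n).filter fun p => p.1 - p.2 ∈ Z).filter fun p => p.1 - p.2 = z : Finset _) := by
      ext p
      simp only [← hF, Finset.coe_filter, Finset.mem_filter, Finset.mem_product, Finset.mem_coe,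
        Set.mem_ofPred_eq]
      constructor
      · rintro ⟨h1, h2, h3⟩; exact ⟨⟨⟨h1, h2⟩, h3 ▸ hz⟩, h3⟩
      · rintro ⟨⟨⟨h1, h2⟩, -⟩, h3⟩; exact ⟨h1, h2, h3⟩
    rw [e2, Set.ncard_coe_finset,
      Finset.sum_congr rfl (g := fun _ => g z) fun p hp => by rw [(Finset.mem_filter.1 hp).2],
      Finset.sum_const, nsmul_eq_mul]
    push_cast
    ring
  simp_rw [key]
  refine tendsto_finsetSum _ fun z hz => Tendsto.mul_const _ ?_
  exact (Complex.continuous_ofReal.tendsto _).comp (h z (hZ.subset hz).1)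

theorem selfConv_sum_trans (φ : C_c(ℝ, ℂ)) (F : Finset ℝ) (t : ℝ) :
    selfConv (∑ x ∈ F, trans φ (-x)) t = ∑ x ∈ F, ∑ y ∈ F, selfConv φ (t + (x - y)) := by
  have e : ∀ s, (∑ x ∈ F, trans φ (-x)) s * starRingEnd ℂ ((∑ x ∈ F, trans φ (-x)) (s - t)) =
      ∑ x ∈ F, ∑ y ∈ F, φ (s - (-x)) * starRingEnd ℂ (φ (s - (t - y))) := fun s => by
    simp only [CompactlySupportedContinuousMap.sum_apply, trans_apply, map_sum,
      Finset.sum_mul_sum, sub_eq_add_neg, neg_add, neg_neg, add_assoc]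
  rw [selfConv_apply]
  simp_rw [e]
  have i := fun x y => integrable_mul_conj φ φ (-x) (t - y)
  rw [integral_finsetSum _ fun x _ => integrable_finsetSum _ fun y _ => i x y]
  refine Finset.sum_congr rfl fun x _ => ?_
  rw [integral_finsetSum _ fun y _ => i x y]
  refine Finset.sum_congr rfl fun y _ => ?_
  rw [selfConv_apply, ← integral_sub_right_eq_self _ x]
  congr 1; ext s; congr 3 <;> ring

/-- Nearby translates are supported in a common compact set and differ uniformly little. This
supplies the continuity needed for Lévy's theorem. -/
theorem RadonMeasure.continuous_trans (μ : RadonMeasure) (g : C_c(ℝ, ℂ)) :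
    Continuous fun a => μ (trans g a) := by
  rw [continuous_iff_continuousAt]
  intro a
  obtain ⟨R, hR0, hR⟩ := exists_bound_support g
  set K : Set ℝ := Set.Icc (-(R + |a| + 1)) (R + |a| + 1)
  obtain ⟨C, hC⟩ := μ.locally_bounded K isCompact_Icc
  rw [Metric.continuousAt_iff]
  intro ε hε
  have hC0 : 0 < |C| + 1 := by positivity
  have hu := g.hasCompactSupport.uniformContinuous_of_continuous g.continuous
  obtain ⟨δ, hδ, hd⟩ := Metric.uniformContinuous_iff.1 hu (ε / (2 * (|C| + 1))) (by positivity)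
  refine ⟨min δ 1, by positivity, fun {b} hb => ?_⟩
  have hb1 : |b - a| < δ := lt_of_lt_of_le hb (min_le_left _ _)
  have hb2 : |b - a| < 1 := lt_of_lt_of_le hb (min_le_right _ _)
  have hsupp : ∀ c, |c - a| < 1 → ∀ x, g (x - c) ≠ 0 → x ∈ K := fun c hc x hx => by
    refine abs_le.1 ?_
    have h1 := hR _ hx
    have h2 : x = (x - c) + (c - a) + a := by ring
    rw [h2]
    have := abs_add_le ((x - c) + (c - a)) a
    have := abs_add_le (x - c) (c - a)
    linarith
  have hle := hC (trans g b - trans g a) (ε / (2 * (|C| + 1))) (by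
    refine closure_minimal (fun x hx => ?_) isClosed_Icc
    by_contra hn
    refine hx ?_
    have h1 : g (x - b) = 0 := by_contra fun h => hn (hsupp b hb2 x h)
    have h2 : g (x - a) = 0 := by_contra fun h => hn (hsupp a (by simp) x h)
    simp [h1, h2]) (fun x => by
      have : dist (x - b) (x - a) < δ := by
        rw [Real.dist_eq]; rw [abs_sub_comm] at hb1; convert hb1 using 2; ring
      have := hd this
      rw [dist_eq_norm] at this
      exact this.le)
  rw [dist_eq_norm, ← map_sub]
  refine lt_of_le_of_lt hle ?_
  have h3 : C * (ε / (2 * (|C| + 1))) ≤ (|C| + 1) * (ε / (2 * (|C| + 1))) := by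
    gcongr
    linarith [le_abs_self C]
  refine h3.trans_lt ?_
  have : (|C| + 1) * (ε / (2 * (|C| + 1))) = ε / 2 := by field_simp
  linarith

/-- The smoothed autocorrelation is the Fourier transform of a finite positive measure. -/
theorem HasAutocorrelation.exists_measure {A : ℕ → Set ℝ} {Λ : Set ℝ} {η : ℝ → ℝ}
    (h : HasAutocorrelation A Λ η) (hΛ : Λ ⊆ Fib) (hA : ∀ n, IsCompact (A n)) (φ : C_c(ℝ, ℂ)) :
    ∃ ν : Measure ℝ, IsFiniteMeasure ν ∧
      ∀ a, ∫ y, ch (a * y) ∂ν = autocorrelation Λ η (trans (selfConv φ) a) := by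
  choose F hF using fun n => (finite_inter hΛ (hA n)).exists_finset_coe
  -- Translating by -x makes the self-convolution of Φ n at -a equal to the double sum of (φ * φ~)(x
  -- - y - a), matching the sign in `selfConv_eq_integral`.
  set Φ : ℕ → C_c(ℝ, ℂ) := fun n => ∑ x ∈ F n, trans φ (-x)
  set d : ℕ → ℝ → ℝ := fun n y => (volume.real (A n))⁻¹ * ‖invFourier (Φ n) y‖ ^ 2 with hd
  have hd0 : ∀ n y, 0 ≤ d n y := fun n y => by positivity
  have hdc : ∀ n, Continuous (d n) := fun n =>
    continuous_const.mul ((continuous_invFourier _).norm.pow 2)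
  have hdi : ∀ n, Integrable (d n) := fun n => (integrable_normSq_invFourier (Φ n)).const_mul _
  have : ∀ n, IsFiniteMeasure (volume.withDensity fun y => ENNReal.ofReal (d n y)) := fun n =>
    isFiniteMeasure_withDensity_ofReal (hdi n).2
  refine exists_measure_of_tendsto (fun n => volume.withDensity fun y => ENNReal.ofReal (d n y))
    (RadonMeasure.continuous_trans _ _) fun a => ?_
  refine (h.tendsto hΛ hF (trans (selfConv φ) a)).congr fun n => ?_
  rw [integral_withDensity_eq_integral_toReal_smul (hdc n).measurable.ennreal_ofReal (by simp)]
  have e : ∀ y, (ENNReal.ofReal (d n y)).toReal • ch (a * y) =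
      (((volume.real (A n))⁻¹ : ℝ) : ℂ) * (ch (a * y) * ((‖invFourier (Φ n) y‖ ^ 2 : ℝ) : ℂ)) :=
    fun y => by
      rw [ENNReal.toReal_ofReal (hd0 n y), Complex.real_smul, hd]; push_cast; ring
  simp_rw [e]
  rw [integral_const_mul, ← selfConv_eq_integral, selfConv_sum_trans]
  congr 1
  refine Finset.sum_congr rfl fun x _ => Finset.sum_congr rfl fun y _ => ?_
  rw [trans_apply]; congr 1; ring

/-! ### Separating functions -/

/-- The self-convolution of `φ` separates the points of the ping-pong measure. -/
structure IsSeparating (φ : C_c(ℝ, ℂ)) : Prop where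
  at_zero : selfConv φ 0 = 1
  off_diag : ∀ i j, h (lp i).2 ≠ 0 → h (lp j).2 ≠ 0 → i ≠ j →
    selfConv φ ((lp j).1 - (lp i).1) = 0

theorem abs_lp_snd_le {i : ℤ × ℤ} (hi : h (lp i).2 ≠ 0) : |(lp i).2| ≤ τ + 2 := by
  by_contra hlt
  exact hi (h_eq_zero (not_le.1 hlt))

/-- The second coordinates differ by at most 2(τ + 2), and the product of the coordinate differences
is at least 1 in modulus. -/
theorem lp_separated {i j : ℤ × ℤ} (hi : h (lp i).2 ≠ 0) (hj : h (lp j).2 ≠ 0) (hij : i ≠ j) :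
    1 / (2 * (τ + 2)) ≤ |(lp j).1 - (lp i).1| := by
  have h1 := one_le_abs_lp_mul (sub_ne_zero.2 hij.symm)
  rw [← lp_sub, Prod.fst_sub, Prod.snd_sub] at h1
  have h2 : |(lp j).2 - (lp i).2| ≤ 2 * (τ + 2) :=
    (abs_sub _ _).trans (by linarith [abs_lp_snd_le hi, abs_lp_snd_le hj])
  have ht := Real.goldenRatio_pos
  rw [div_le_iff₀ (by positivity)]
  exact h1.trans (mul_le_mul_of_nonneg_left h2 (abs_nonneg _))

theorem exists_isSeparating : ∃ φ, IsSeparating φ := by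
  have ht := Real.goldenRatio_pos
  -- Half the minimal distance between points of ω, so a bump of radius r and its translates by
  -- differences of distinct points do not overlap.
  set r : ℝ := 1 / (4 * (τ + 2)) with hr
  have hr0 : 0 < r := by positivity
  let b : ContDiffBump (0 : ℝ) := ⟨r / 2, r, by positivity, by linarith⟩
  have hbc : HasCompactSupport fun x => (b x : ℂ) := b.hasCompactSupport.comp_left (g := Complex.ofReal) rfl
  let ψ : C_c(ℝ, ℂ) := ⟨⟨fun x => (b x : ℂ), Complex.continuous_ofReal.comp b.continuous⟩, hbc⟩
  have hψ : ∀ x, ψ x = (b x : ℂ) := fun _ => rfl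
  set c : ℝ := ∫ x, b x ^ 2
  have hc : 0 < c := by
    refine (b.continuous.pow 2).integral_pos_of_hasCompactSupport_nonneg_nonzero
      (x := 0) ?_ (fun x => by positivity) ?_
    · exact b.hasCompactSupport.comp_left (g := fun x => x ^ 2) (by simp)
    · simp [b.one_of_mem_closedBall (x := 0) (by simp [b.rIn_pos.le])]
  refine ⟨((√c)⁻¹ : ℂ) • ψ, ?_, ?_⟩
  · rw [selfConv_apply]
    have e : ∀ s, (((√c)⁻¹ : ℂ) • ψ) s * starRingEnd ℂ ((((√c)⁻¹ : ℂ) • ψ) (s - 0)) =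
        ((c⁻¹ * b s ^ 2 : ℝ) : ℂ) := fun s => by
      have hs : ((√c : ℝ) : ℂ) * (√c : ℝ) = (c : ℝ) := by
        rw [← Complex.ofReal_mul, Real.mul_self_sqrt hc.le]
      simp only [CompactlySupportedContinuousMap.smul_apply, sub_zero, smul_eq_mul, map_mul,
        map_inv₀, Complex.conj_ofReal, hψ]
      push_cast
      rw [← hs, mul_inv]
      ring
    simp_rw [e]
    rw [integral_complex_ofReal, integral_const_mul, inv_mul_cancel₀ hc.ne', Complex.ofReal_one]
  · intro i j hi hj hij
    have h1 := lp_separated hi hj hij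
    have hr2 : 1 / (2 * (τ + 2)) = 2 * r := by rw [hr]; field_simp; norm_num
    rw [hr2] at h1
    rw [selfConv_apply]
    refine integral_eq_zero_of_ae (Eventually.of_forall fun s => ?_)
    set t := (lp j).1 - (lp i).1
    have hz : ∀ x, r ≤ |x| → ψ x = 0 := fun x hx => by
      rw [hψ, b.zero_of_le_dist (by simpa using hx), Complex.ofReal_zero]
    have : r ≤ |s| ∨ r ≤ |s - t| := by
      by_contra hn
      push Not at hn
      have : t = s - (s - t) := by ring
      rw [this] at h1
      linarith [abs_sub s (s - t)]
    rcases this with h | h <;> simp [hz _ h]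

/-- By separation, a bump around the point meets no other point of nonzero weight, so ω takes the
value h there on it. -/
theorem lp_mem_support {i : ℤ × ℤ} (hi : h (lp i).2 ≠ 0) : (lp i).1 ∈ omega.support := by
  intro U hU
  have ht := Real.goldenRatio_pos
  obtain ⟨f, hf1, hf2, hf3, -, hf5⟩ := exists_contDiff_tsupport_subset (n := 0)
    (inter_mem hU (Metric.ball_mem_nhds (lp i).1 (show 0 < 1 / (2 * (τ + 2)) by positivity)))
  let g : C_c(ℝ, ℂ) := ⟨⟨fun x => (f x : ℂ), Complex.continuous_ofReal.comp hf3.continuous⟩,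
    hf2.comp_left (g := Complex.ofReal) rfl⟩
  have hg : ∀ x, g x = (f x : ℂ) := fun _ => rfl
  have hgf : tsupport g ⊆ tsupport f := closure_mono fun x hx => by
    simpa [hg] using hx
  refine ⟨g, fun x hx => (hf1 (hgf hx)).1, ?_⟩
  rw [omega_apply, tsum_eq_single i]
  · rw [hg, hf5, hc_apply]
    simpa using hi
  · intro j hj
    by_cases hj0 : h (lp j).2 = 0
    · rw [hc_apply, hj0]; simp
    · have h1 := lp_separated hi hj0 hj.symm
      have : g (lp j).1 = 0 := by
        by_contra h0
        have := (hf1 (hgf (subset_tsupport _ h0))).2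
        rw [Metric.mem_ball, Real.dist_eq] at this
        linarith
      rw [this, zero_mul]

/-- If φ * φ~ were nonzero at y - x, then y - x would lie in U, and y would belong to both x + U and
y + U. -/
theorem IsAuxiliary.isSeparating {φ : C_c(ℝ, ℂ)} (hφ : IsAuxiliary omega φ) : IsSeparating φ := by
  obtain ⟨U, -, h0, hU, hs, h1⟩ := hφ
  refine ⟨h1, fun i j hi hj hij => ?_⟩
  by_contra hne
  have hd := hU _ (lp_mem_support hi) _ (lp_mem_support hj) fun h => hij (lp_fst_injective h)
  have h2 : (lp j).1 ∈ (lp i).1 +ᵥ U :=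
    Set.mem_vadd_set.2 ⟨_, hs (subset_tsupport _ hne), by simp⟩
  exact Set.disjoint_left.1 hd h2 (Set.mem_vadd_set.2 ⟨0, h0, by simp⟩)

/-! ### Convolution with finite measures -/

theorem TranslationBounded.conv {m ν : Measure ℝ} [SFinite m] [IsFiniteMeasure ν]
    (h : TranslationBounded m) : TranslationBounded (m.conv ν) := by
  obtain ⟨C, hC, hb⟩ := h
  refine ⟨C * ν Set.univ, ENNReal.mul_ne_top hC (measure_ne_top _ _), fun x => ?_⟩
  rw [Measure.conv, Measure.map_apply (by fun_prop) measurableSet_Icc,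
    Measure.prod_apply_symm (measurableSet_Icc.preimage (by fun_prop)),
    ← lintegral_const]
  refine lintegral_mono fun y => le_trans (measure_mono ?_) (hb (x - y))
  rintro s ⟨h1, h2⟩
  constructor <;> simp only at h1 h2 ⊢ <;> linarith

theorem integrable_prod_of_conv {m ν : Measure ℝ} {f : ℝ → ℂ} (hf : Integrable f (m.conv ν)) :
    Integrable (fun p : ℝ × ℝ => f (p.1 + p.2)) (m.prod ν) :=
  hf.comp_measurable (measurable_fst.add measurable_snd)

theorem integral_conv_eq {m ν : Measure ℝ} [SFinite m] [SFinite ν] {f : ℝ → ℂ}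
    (hf : Integrable f (m.conv ν)) : ∫ x, f x ∂(m.conv ν) = ∫ y, ∫ s, f (s + y) ∂m ∂ν := by
  rw [Measure.conv, integral_map (by fun_prop) hf.aestronglyMeasurable,
    integral_prod_symm _ (integrable_prod_of_conv hf)]

/-! ### The ping-pong identity -/

/-- On Λ - Λ, where h = 1, the translated self-convolution picks out the one coefficient η(z). At
the other points of nonzero weight it vanishes on all of Λ - Λ. -/
theorem IsSeparating.autocorrelation_apply {φ : C_c(ℝ, ℂ)} (hφ : IsSeparating φ) {Λ : Set ℝ}
    (hΛ : Λ ⊆ Fib) (η : ℝ → ℝ) (g : C_c(ℝ, ℂ)) :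
    autocorrelation Λ η g = ∑' i, g (lp i).1 * hc (lp i).2 *
      autocorrelation Λ η (trans (selfConv φ) (lp i).1) := by
  choose e he1 he2 using fun z : ↥(Λ - Λ) => Fib_sub hΛ z.2
  have hinj : Function.Injective e := fun z w hzw => by
    ext; rw [← he1, ← he1, hzw]
  have h1 : ∀ z, h (lp (e z)).2 = 1 := fun z => h_eq_one (he2 z)
  have h0 : ∀ z, h (lp (e z)).2 ≠ 0 := fun z => by rw [h1]; exact one_ne_zero
  rw [FibPingPong.autocorrelation_apply hΛ, ← hinj.tsum_eq]
  · refine tsum_congr fun z => ?_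
    rw [FibPingPong.autocorrelation_apply hΛ, tsum_eq_single z, hc_apply, h1, he1, trans_apply,
      sub_self, hφ.at_zero]
    · push_cast; ring
    · intro w hw
      rw [trans_apply, ← he1 w, hφ.off_diag _ _ (h0 z) (h0 w) fun h => hw (hinj h.symm), mul_zero]
  · intro i hi
    by_contra hn
    refine hi ?_
    by_cases hz : h (lp i).2 = 0
    · simp [hc_apply, hz]
    · dsimp only
      rw [FibPingPong.autocorrelation_apply hΛ]
      refine mul_eq_zero_of_right _ ((tsum_congr fun z => ?_).trans tsum_zero)
      rw [trans_apply, ← he1 z, hφ.off_diag _ _ hz (h0 z) fun h => hn ⟨z, h.symm⟩, mul_zero]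

/-- Insert the integral over ν into the ping-pong identity and exchange it with the sum, which is
finite. The factor ch(x y) modulates ψ, and hence shifts |ψˇ|² by y, so integrating over ν yields
the convolution of ω̂ with ν. -/
theorem IsSeparating.isFourierTransform {φ : C_c(ℝ, ℂ)} (hφ : IsSeparating φ) {Λ : Set ℝ}
    (hΛ : Λ ⊆ Fib) {η : ℝ → ℝ} {ν : Measure ℝ} [IsFiniteMeasure ν]
    [IsLocallyFiniteMeasure (omegaPos.conv ν)] [IsLocallyFiniteMeasure (omegaNeg.conv ν)]
    (hν : ∀ a, ∫ y, ch (a * y) ∂ν = autocorrelation Λ η (trans (selfConv φ) a)) :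
    IsFourierTransform (autocorrelation Λ η)
      (diffMeasure (omegaPos.conv ν) (omegaNeg.conv ν)) := by
  have hp := translationBounded_omegaPos.conv (ν := ν)
  have hq := translationBounded_omegaNeg.conv (ν := ν)
  refine isFourierTransform_diffMeasure hp hq fun ψ => ?_
  have hN : ∀ y s, normSqInvFourier ψ (s + y) = normSqInvFourier (modul ψ y) s := fun y s => by
    simp [normSqInvFourier, invFourier_modul]
  have ip := (integrable_prod_of_conv (hp.integrable_normSqInvFourier ψ)).integral_prod_right
  have iq := (integrable_prod_of_conv (hq.integrable_normSqInvFourier ψ)).integral_prod_right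
  rw [integral_conv_eq (hp.integrable_normSqInvFourier ψ),
    integral_conv_eq (hq.integrable_normSqInvFourier ψ), ← integral_sub ip iq]
  simp_rw [hN, ← omega_selfConv, omega_apply, selfConv_modul]
  rw [hφ.autocorrelation_apply hΛ]
  simp_rw [← hν]
  set T := (finite_support_lp (selfConv ψ) hc).toFinset
  have hT : ∀ i ∉ T, selfConv ψ (lp i).1 * hc (lp i).2 = 0 := fun i hi => by
    by_contra h0
    exact hi ((Set.Finite.mem_toFinset _).2 h0)
  rw [tsum_eq_sum (s := T) fun i hi => by rw [hT i hi, zero_mul]]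
  have e : ∀ y, ∑' i, ch (y * (lp i).1) * selfConv ψ (lp i).1 * hc (lp i).2 =
      ∑ i ∈ T, selfConv ψ (lp i).1 * hc (lp i).2 * ch ((lp i).1 * y) := fun y => by
    rw [tsum_eq_sum (s := T) fun i hi => by rw [mul_assoc, hT i hi, mul_zero]]
    refine Finset.sum_congr rfl fun i _ => ?_
    rw [mul_comm y]; ring
  simp_rw [e]
  rw [integral_finsetSum]
  · exact Finset.sum_congr rfl fun i _ => (integral_const_mul _ _).symm
  · intro i _
    refine Integrable.const_mul ?_ _
    simpa using integrable_ch_mul (integrable_const (μ := ν) (1 : ℂ))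
      (k := fun y => (lp i).1 * y) (by fun_prop)

/-! ### The product of the transform with `|φˇ|²` -/

theorem isPolar_diffMeasure_zero (ν : Measure ℝ) [IsLocallyFiniteMeasure ν] :
    (diffMeasure ν 0).IsPolar ν 1 :=
  ⟨inferInstance, measurable_one, by simp, fun g => by simp [diffMeasure_apply]⟩

theorem isFinite_diffMeasure_zero (ν : Measure ℝ) [IsFiniteMeasure ν] :
    (diffMeasure ν 0).IsFinite := by
  refine ⟨ν.real Set.univ, fun g b hb => ?_⟩
  rw [diffMeasure_apply, integral_zero_measure, sub_zero, mul_comm]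
  exact norm_integral_le_of_norm_le_const (Eventually.of_forall hb)

theorem memLp_invFourier_of_isFiniteMeasure (ν : Measure ℝ) [IsFiniteMeasure ν] (φ : C_c(ℝ, ℂ)) :
    MemLp (invFourier φ) 2 ν :=
  MemLp.of_bound (continuous_invFourier φ).aestronglyMeasurable (∫ x, ‖φ x‖)
    (Eventually.of_forall fun y => norm_invFourier_le φ y)

theorem normSqInvFourier_eq_integral (ψ : C_c(ℝ, ℂ)) (y : ℝ) :
    normSqInvFourier ψ y = ∫ w, ch (w * y) * selfConv ψ w := by
  rw [← invFourier_eq, invFourier_eq_fourier, fourier_selfConv, neg_neg]; rfl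

/-- By polarization both finite measures have the Fourier transform a ↦ γ(trans (selfConv φ) a). The
uniqueness criterion asks for a further factor |ψˇ|², which `shift` absorbs by writing it as a
transform. -/
theorem IsFourierTransform.mulContinuous_eq {γ σ : RadonMeasure} (hσ : IsFourierTransform γ σ)
    {φ : C_c(ℝ, ℂ)} {ν : Measure ℝ} [IsFiniteMeasure ν]
    (hν : ∀ a, ∫ y, ch (a * y) ∂ν = γ (trans (selfConv φ) a)) :
    RadonMeasure.mulContinuous (normSqInvFourier φ) σ = diffMeasure ν 0 := by
  obtain ⟨m, u, hm, hf⟩ := hσ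
  have := hm.locallyFinite
  set N : ℝ → ℝ := fun y => ‖invFourier φ y‖ ^ 2 with hN
  have hNc : Continuous N := (continuous_invFourier φ).norm.pow 2
  have hNi : Integrable N m := (hf φ).1.integrable_norm_pow (p := 2) two_ne_zero
  have hden : ∀ f : ℝ → ℂ, ∫ y, f y ∂(m.withDensity fun y => ENNReal.ofReal (N y)) =
      ∫ y, (N y : ℂ) * f y ∂m := fun f => by
    rw [integral_withDensity_eq_integral_toReal_smul hNc.measurable.ennreal_ofReal (by simp)]
    refine integral_congr_ae (Eventually.of_forall fun y => ?_)
    dsimp only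
    rw [ENNReal.toReal_ofReal (by positivity), Complex.real_smul]
  have hfin : IsFiniteMeasure (m.withDensity fun y => ENNReal.ofReal (N y)) :=
    isFiniteMeasure_withDensity_ofReal hNi.2
  have hp : (RadonMeasure.mulContinuous (normSqInvFourier φ) σ).IsPolar
      (m.withDensity fun y => ENNReal.ofReal (N y)) u := by
    refine ⟨inferInstance, hm.measurable, hm.norm_eq_one, fun g => ?_⟩
    rw [hden]
    change σ (normSqInvFourier φ • g) = _
    rw [hm.apply_eq]
    refine integral_congr_ae (Eventually.of_forall fun y => ?_)
    simp [normSqInvFourier, hN, mul_assoc]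
  refine RadonMeasure.eq_of_integral_ch_eq hp (isPolar_diffMeasure_zero ν)
    (memLp_invFourier_of_isFiniteMeasure _) (memLp_invFourier_of_isFiniteMeasure _) fun ψ a => ?_
  have iu : Integrable (fun y => normSqInvFourier φ y * u y) m :=
    integrable_normSq_mul hm.measurable hm.norm_eq_one (hf φ).1
  have key : ∀ b, ∫ y, ch (b * y) * (normSqInvFourier φ y * u y) ∂m = ∫ y, ch (b * y) * 1 ∂ν :=
    fun b => by
      rw [← apply_trans_selfConv hm.measurable hm.norm_eq_one hf, ← hν]; simp
  have shift : ∀ {M : Measure ℝ} [SFinite M] {k : ℝ → ℂ}, Integrable k M →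
      ∫ y, ch (a * y) * (normSqInvFourier ψ y * k y) ∂M =
        ∫ w, selfConv ψ w * ∫ y, ch ((w + a) * y) * k y ∂M := fun {M} _ {k} hk => by
    have := integral_fourier_mul (integrable_ch_mul hk (k := fun y => a * y) (by fun_prop))
      (integrable_cc (selfConv ψ))
    simp only [← normSqInvFourier_eq_integral] at this
    calc _ = ∫ y, normSqInvFourier ψ y * (ch (a * y) * k y) ∂M := by congr 1; ext y; ring
      _ = _ := by
        rw [this]
        congr 1; ext w; congr 2; ext y
        rw [add_mul, ch_add, mul_assoc]
  have e1 := shift iu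
  have e2 := shift (M := ν) (integrable_const (1 : ℂ))
  rw [hden]
  calc _ = ∫ y, ch (a * y) * (normSqInvFourier ψ y * (normSqInvFourier φ y * u y)) ∂m := by
        congr 1; ext y
        change (N y : ℂ) * _ = ch (a * y) * (_ * ((N y : ℂ) * u y))
        ring
    _ = _ := by
        rw [e1]
        simp_rw [key]
        rw [← e2]; rfl

/-! ### The convolution identity -/

/-- Translation boundedness of |p - q| gives absolute integrability against a finite ν. The formula
is then Fubini, with the polar identity applied to each translate of g. -/
theorem isConvolution_diffMeasure {p q ν : Measure ℝ} [IsLocallyFiniteMeasure p]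
    [IsLocallyFiniteMeasure q] [IsFiniteMeasure ν] [IsLocallyFiniteMeasure (p.conv ν)]
    [IsLocallyFiniteMeasure (q.conv ν)] (hp : TranslationBounded p) (hq : TranslationBounded q) :
    RadonMeasure.IsConvolution (diffMeasure p q) (diffMeasure ν 0)
      (diffMeasure (p.conv ν) (q.conv ν)) := by
  obtain ⟨m, u, hle, hum, hu, hpq⟩ := exists_polar p q
  have ht := (hp.add hq).mono hle
  have := (hp.add hq).isLocallyFinite
  have := ht.isLocallyFinite
  have := (ht.conv (ν := ν)).isLocallyFinite
  refine ⟨m, u, ν, 1, ⟨inferInstance, hum, hu, fun g => ?_⟩, isPolar_diffMeasure_zero ν,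
    fun g => ?_⟩
  · rw [hpq _ (integrable_cc' g _), diffMeasure_apply]
  have i : Integrable (fun p : ℝ × ℝ => g (p.1 + p.2)) (m.prod ν) :=
    integrable_prod_of_conv (integrable_cc' g _)
  refine ⟨i, ?_⟩
  have iu : Integrable (fun p : ℝ × ℝ => g (p.1 + p.2) * u p.1) (m.prod ν) :=
    i.mul_bdd (c := 1) (hum.comp measurable_fst).aestronglyMeasurable
      (Eventually.of_forall fun x => (hu x.1).le)
  have ip := integrable_prod_of_conv (integrable_cc' g (p.conv ν))
  have iq := integrable_prod_of_conv (integrable_cc' g (q.conv ν))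
  simp only [Pi.one_apply, mul_one]
  rw [diffMeasure_apply, integral_conv_eq (integrable_cc' g _),
    integral_conv_eq (integrable_cc' g _), integral_prod_symm _ iu,
    ← integral_sub ip.integral_prod_right iq.integral_prod_right]
  refine integral_congr_ae (Eventually.of_forall fun y => ?_)
  have hg : ∀ s, trans g (-y) s = g (s + y) := fun s => by rw [trans_apply, sub_neg_eq_add]
  have := hpq _ (integrable_cc' (trans g (-y)) _)
  simp only [hg] at this
  exact this.symm

end FibPingPong

end

/-! ### Assembly of parts (a) and (b) -/

theorem mainTheorem10 :
    -- part (a): both sums define measures, and the second is the transform of the first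
    (FibPingPong.LocallySummable (fun p : FibPingPong.lattice => p.1.1)
        (fun p => (FibPingPong.h p.1.2 : ℂ)) ∧
      FibPingPong.FourierTransformable FibPingPong.omega ∧
      FibPingPong.LocallySummable (fun y : FibPingPong.dualLattice => y.1.1)
        (fun y => (FibPingPong.omegaHatWeight y.1.2 : ℂ)) ∧
      FibPingPong.fourierTransform FibPingPong.omega =
        FibPingPong.diracComb (fun y : FibPingPong.dualLattice => y.1.1)
          (fun y => (FibPingPong.omegaHatWeight y.1.2 : ℂ))) ∧
    -- part (b): for every subset with an autocorrelation along some van Hove sequence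
    (∀ Λ : Set ℝ, Λ ⊆ FibPingPong.Fib → ∀ A : ℕ → Set ℝ, FibPingPong.IsVanHove A →
      ∀ η : ℝ → ℝ, FibPingPong.HasAutocorrelation A Λ η →
        FibPingPong.LocallySummable (fun z : ↥(Λ - Λ) => (z : ℝ)) (fun z => (η z : ℂ)) ∧
        FibPingPong.FourierTransformable (FibPingPong.autocorrelation Λ η) ∧
        ∀ φ : C_c(ℝ, ℂ), FibPingPong.IsAuxiliary FibPingPong.omega φ →
          (FibPingPong.RadonMeasure.mulContinuous (FibPingPong.normSqInvFourier φ)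
            (FibPingPong.fourierTransform (FibPingPong.autocorrelation Λ η))).IsFinite ∧
          FibPingPong.RadonMeasure.IsConvolution
            (FibPingPong.fourierTransform FibPingPong.omega)
            (FibPingPong.RadonMeasure.mulContinuous (FibPingPong.normSqInvFourier φ)
              (FibPingPong.fourierTransform (FibPingPong.autocorrelation Λ η)))
            (FibPingPong.fourierTransform (FibPingPong.autocorrelation Λ η))) := by
  refine ⟨⟨FibPingPong.locallySummable_omega, ⟨_, FibPingPong.isFourierTransform_omega⟩,
    FibPingPong.locallySummable_dual.1, FibPingPong.isFourierTransform_omega.fourierTransform_eq.trans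
      FibPingPong.locallySummable_dual.2.symm⟩, fun Λ hΛ A hA η hη => ?_⟩
  have key : ∀ φ, FibPingPong.IsSeparating φ → ∃ (ν : Measure ℝ) (_ : IsFiniteMeasure ν)
      (_ : IsLocallyFiniteMeasure (FibPingPong.omegaPos.conv ν))
      (_ : IsLocallyFiniteMeasure (FibPingPong.omegaNeg.conv ν)),
      (∀ a, ∫ y, FibPingPong.ch (a * y) ∂ν = FibPingPong.autocorrelation Λ η
        (FibPingPong.trans (FibPingPong.selfConv φ) a)) ∧
      FibPingPong.IsFourierTransform (FibPingPong.autocorrelation Λ η) (FibPingPong.diffMeasure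
        (FibPingPong.omegaPos.conv ν) (FibPingPong.omegaNeg.conv ν)) := fun φ hφ => by
    obtain ⟨ν, hf, hν⟩ := hη.exists_measure hΛ hA.isCompact φ
    have := (FibPingPong.translationBounded_omegaPos.conv (ν := ν)).isLocallyFinite
    have := (FibPingPong.translationBounded_omegaNeg.conv (ν := ν)).isLocallyFinite
    exact ⟨ν, hf, inferInstance, inferInstance, hν, hφ.isFourierTransform hΛ hν⟩
  refine ⟨FibPingPong.locallySummable_autocorrelation hΛ η, ?_, fun φ hφ => ?_⟩
  -- Transformability is independent of any given auxiliary function, so a constructed separating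
  -- one is used here.
  · obtain ⟨φ, hφ⟩ := FibPingPong.exists_isSeparating
    obtain ⟨ν, _, _, _, -, h⟩ := key φ hφ
    exact ⟨_, h⟩
  · obtain ⟨ν, _, _, _, hν, h⟩ := key φ hφ.isSeparating
    rw [h.fourierTransform_eq, FibPingPong.isFourierTransform_omega.fourierTransform_eq,
      h.mulContinuous_eq hν]
    exact ⟨FibPingPong.isFinite_diffMeasure_zero ν, FibPingPong.isConvolution_diffMeasure
      FibPingPong.translationBounded_omegaPos FibPingPong.translationBounded_omegaNeg⟩
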